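/- Let $n \ge 0$ and let $\Gamma$ be an $n$-space group, that is, a discrete subgroup of the group $\mathrm{Isom}(E^n)$ of isometries of Euclidean $n$-space (with the compact-open topology) whose orbit space $E^n/\Gamma$ is compact. Give $E^n/\Gamma$ the orbit-space metric $d(\Gamma x,\Gamma y)=\inf\{|x'-y'| : x'\in\Gamma x,\ y'\in\Gamma y\}$, and its isometry group $\mathrm{Isom}(E^n/\Gamma)$ the compact-open topology. Let $Z(\Gamma)$ be the center of $\Gamma$, and let $V=\mathrm{Span}(Z(\Gamma))$ be the linear span of the vectors $a$ such that the translation $x\mapsto a+x$ belongs to $Z(\Gamma)$. Let $\beta_1$ be the first Betti number of $\Gamma$, that is, the rank of the abelian group $\Gamma/[\Gamma,\Gamma]$. Then every element of $Z(\Gamma)$ is a translation by a vector of $V$, so that $Z(\Gamma)$ may be regarded as a subgroup of $V$, and $V/Z(\Gamma)$ is a torus of dimension $\beta_1$. The group $\mathrm{Isom}(E^n/\Gamma)$ is a compact Lie group, of dimension $\beta_1$. The formula $(Z(\Gamma)v)(\Gamma x)=\Gamma(v+x)$, for $v\in V$ and $x\in E^n$, defines an effective action of $V/Z(\Gamma)$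 on $E^n/\Gamma$ by isometries, and the corresponding homomorphism $V/Z(\Gamma)\to\mathrm{Isom}(E^n/\Gamma)$ is an isomorphism of Lie groups onto the connected component of the identity of $\mathrm{Isom}(E^n/\Gamma)$, which is therefore a torus. The rank of the compact Lie group $\mathrm{Isom}(E^n/\Gamma)$ (the largest dimension of a torus subgroup) is $\beta_1$. -/

import Mathlib

open scoped Manifold ContDiff

noncomputable section

/-- Euclidean `n`-space. -/
abbrev EuclSp (n : ℕ) : Type := EuclideanSpace ℝ (Fin n)

/-- The compact-open topology on the group of isometries of a (pseudo)metric space `X`: the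
topology inherited from the space `C(X, X)` of continuous self-maps. -/
instance isomTopology (X : Type*) [PseudoMetricSpace X] : TopologicalSpace (X ≃ᵢ X) :=
  TopologicalSpace.induced (fun f : X ≃ᵢ X => (⟨f, f.continuous⟩ : C(X, X))) inferInstance

/-- The group `Isom(Eⁿ)` of isometries of Euclidean `n`-space; the product is composition. -/
abbrev EuclIsom (n : ℕ) : Type := EuclSp n ≃ᵢ EuclSp n

/-- The tautological action of `Isom(Eⁿ)` on `Eⁿ`. -/
instance euclIsomAction (n : ℕ) : MulAction (EuclIsom n) (EuclSp n) where
  smul f x := f x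
  one_smul _ := rfl
  mul_smul _ _ _ := rfl

theorem euclIsom_smul_def {n : ℕ} (f : EuclIsom n) (x : EuclSp n) : f • x = f x := rfl

instance euclIsomIsometric (n : ℕ) : IsIsometricSMul (EuclIsom n) (EuclSp n) where
  isometry_smul f := f.isometry

instance euclSubgroupIsometric {n : ℕ} (Γ : Subgroup (EuclIsom n)) :
    IsIsometricSMul Γ (EuclSp n) where
  isometry_smul f := (f : EuclIsom n).isometry

/-- The orbit space `Eⁿ/Γ` (with the quotient topology). -/
abbrev OrbitSp {n : ℕ} (Γ : Subgroup (EuclIsom n)) : Type :=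
  MulAction.orbitRel.Quotient Γ (EuclSp n)

/-- The orbit `Γx` as a point of `Eⁿ/Γ`. -/
def orbitPt {n : ℕ} (Γ : Subgroup (EuclIsom n)) (x : EuclSp n) : OrbitSp Γ :=
  Quotient.mk (MulAction.orbitRel Γ (EuclSp n)) x

/-- The distance between the orbits `Γx` and `Γy` in `Eⁿ`. -/
def preOrbitDist {n : ℕ} (Γ : Subgroup (EuclIsom n)) (x y : EuclSp n) : ℝ :=
  ⨅ γ : Γ, dist x (γ • y)

theorem preOrbitDist_bdd {n : ℕ} (Γ : Subgroup (EuclIsom n)) (x y : EuclSp n) :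
    BddBelow (Set.range fun γ : Γ => dist x (γ • y)) :=
  ⟨0, by rintro _ ⟨γ, rfl⟩; exact dist_nonneg⟩

theorem preOrbitDist_le {n : ℕ} (Γ : Subgroup (EuclIsom n)) (x y : EuclSp n) (γ : Γ) :
    preOrbitDist Γ x y ≤ dist x (γ • y) :=
  ciInf_le (preOrbitDist_bdd Γ x y) γ

theorem preOrbitDist_smul_right {n : ℕ} (Γ : Subgroup (EuclIsom n)) (x y : EuclSp n) (δ : Γ) :
    preOrbitDist Γ x (δ • y) = preOrbitDist Γ x y := by
  unfold preOrbitDist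
  refine (Equiv.mulRight δ).iInf_congr fun γ => ?_
  simp [mul_smul]

theorem preOrbitDist_comm {n : ℕ} (Γ : Subgroup (EuclIsom n)) (x y : EuclSp n) :
    preOrbitDist Γ x y = preOrbitDist Γ y x := by
  unfold preOrbitDist
  refine (Equiv.inv Γ).iInf_congr fun γ => ?_
  rw [Equiv.inv_apply, dist_comm, ← dist_smul γ (γ⁻¹ • x) y, smul_inv_smul]

theorem preOrbitDist_smul_left {n : ℕ} (Γ : Subgroup (EuclIsom n)) (x y : EuclSp n) (δ : Γ) :
    preOrbitDist Γ (δ • x) y = preOrbitDist Γ x y := by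
  rw [preOrbitDist_comm, preOrbitDist_smul_right, preOrbitDist_comm]

theorem preOrbitDist_lt_iff {n : ℕ} (Γ : Subgroup (EuclIsom n)) (x y : EuclSp n) (r : ℝ) :
    preOrbitDist Γ x y < r ↔ ∃ γ : Γ, dist x (γ • y) < r :=
  ciInf_lt_iff (preOrbitDist_bdd Γ x y)

theorem preOrbitDist_self {n : ℕ} (Γ : Subgroup (EuclIsom n)) (x : EuclSp n) :
    preOrbitDist Γ x x = 0 := by
  refine le_antisymm ?_ (Real.iInf_nonneg fun _ => dist_nonneg)
  simpa using preOrbitDist_le Γ x x 1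

theorem preOrbitDist_triangle {n : ℕ} (Γ : Subgroup (EuclIsom n)) (x y z : EuclSp n) :
    preOrbitDist Γ x z ≤ preOrbitDist Γ x y + preOrbitDist Γ y z := by
  refine le_of_forall_pos_lt_add fun ε hε => ?_
  obtain ⟨γ, hγ⟩ := (preOrbitDist_lt_iff Γ x y (preOrbitDist Γ x y + ε / 2)).1 (by linarith)
  obtain ⟨δ, hδ⟩ := (preOrbitDist_lt_iff Γ y z (preOrbitDist Γ y z + ε / 2)).1 (by linarith)
  have h1 := preOrbitDist_le Γ x z (γ * δ)
  have h2 := dist_triangle x (γ • y) ((γ * δ) • z)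
  rw [mul_smul, dist_smul] at h2
  rw [mul_smul] at h1
  linarith

/-- The orbit-space distance `d(Γx, Γy) = inf {|x' - y'| : x' ∈ Γx, y' ∈ Γy}`. -/
def orbitDist {n : ℕ} (Γ : Subgroup (EuclIsom n)) : OrbitSp Γ → OrbitSp Γ → ℝ :=
  Quotient.lift₂ (preOrbitDist Γ) (by
    rintro _ _ x y ⟨γ, rfl⟩ ⟨δ, rfl⟩
    exact (preOrbitDist_smul_left Γ x _ γ).trans (preOrbitDist_smul_right Γ x y δ))

/-- The orbit-space (pseudo)metric, before its topology is identified. -/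
abbrev orbitPreMetric {n : ℕ} (Γ : Subgroup (EuclIsom n)) : PseudoMetricSpace (OrbitSp Γ) where
  dist := orbitDist Γ
  dist_self := by rintro ⟨x⟩; exact preOrbitDist_self Γ x
  dist_comm := by rintro ⟨x⟩ ⟨y⟩; exact preOrbitDist_comm Γ x y
  dist_triangle := by rintro ⟨x⟩ ⟨y⟩ ⟨z⟩; exact preOrbitDist_triangle Γ x y z

/-- The orbit-space metric induces the quotient topology. -/
theorem orbitPreMetric_topology {n : ℕ} (Γ : Subgroup (EuclIsom n)) :
    (inferInstance : TopologicalSpace (OrbitSp Γ)) =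
      (orbitPreMetric Γ).toUniformSpace.toTopologicalSpace := by
  refine TopologicalSpace.ext_iff.2 fun s => ?_
  rw [@Metric.isOpen_iff _ (orbitPreMetric Γ) s]
  have hq : IsOpen s ↔ IsOpen (orbitPt Γ ⁻¹' s) := Iff.rfl
  refine hq.trans (Metric.isOpen_iff.trans ⟨fun h => ?_, fun h => ?_⟩)
  · rintro ⟨x⟩ hx
    obtain ⟨ε, hε, hs⟩ := h x hx
    refine ⟨ε, hε, ?_⟩
    rintro ⟨y⟩ hy
    obtain ⟨γ, hγ⟩ := (preOrbitDist_lt_iff Γ x y ε).1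
      ((preOrbitDist_comm Γ x y).trans_lt hy)
    have h1 : orbitPt Γ (γ • y) ∈ s := hs (by rwa [Metric.mem_ball, dist_comm])
    have h2 : orbitPt Γ (γ • y) = orbitPt Γ y := Quotient.sound ⟨γ, rfl⟩
    rw [h2] at h1
    exact h1
  · intro x hx
    obtain ⟨ε, hε, hs⟩ := h (orbitPt Γ x) hx
    refine ⟨ε, hε, fun y hy => hs ?_⟩
    have h1 := preOrbitDist_le Γ y x 1
    rw [one_smul] at h1
    exact lt_of_le_of_lt h1 hy

/-- `Eⁿ/Γ` with the orbit-space metric; its topology is the quotient topology. When `Γ` is discrete,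
distinct orbits have positive distance. -/
instance orbitMetric {n : ℕ} (Γ : Subgroup (EuclIsom n)) : PseudoMetricSpace (OrbitSp Γ) :=
  (orbitPreMetric Γ).replaceTopology (orbitPreMetric_topology Γ)

/-- An `n`-space group: a discrete group `Γ` of isometries of `Eⁿ` with compact orbit space. -/
structure IsSpaceGroup {n : ℕ} (Γ : Subgroup (EuclIsom n)) : Prop where
  discrete : DiscreteTopology Γ
  compact : CompactSpace (OrbitSp Γ)

/-- `Isom(Eⁿ/Γ)`, the group of isometries of the orbit space, with the compact-open topology. -/
abbrev OrbitIsom {n : ℕ} (Γ : Subgroup (EuclIsom n)) : Type := OrbitSp Γ ≃ᵢ OrbitSp Γ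

/-- The translation `a + I : x ↦ a + x`. -/
abbrev euclTranslation {n : ℕ} (a : EuclSp n) : EuclIsom n := IsometryEquiv.addLeft a

/-- `Span(H)`, the linear span of `{a : a + I ∈ H}`. -/
def translationSpan {n : ℕ} (H : Subgroup (EuclIsom n)) : Submodule ℝ (EuclSp n) :=
  Submodule.span ℝ {a | euclTranslation a ∈ H}

/-- The center `Z(Γ)`, as a subgroup of `Isom(Eⁿ)`. -/
def centerIn {n : ℕ} (Γ : Subgroup (EuclIsom n)) : Subgroup (EuclIsom n) :=
  (Subgroup.center Γ).map Γ.subtype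

/-- `V = Span(Z(Γ))`. -/
abbrev centerSpan {n : ℕ} (Γ : Subgroup (EuclIsom n)) : Submodule ℝ (EuclSp n) :=
  translationSpan (centerIn Γ)

/-- `Z(Γ)` as a group of vectors of `V = Span(Z(Γ))`, a translation `v + I` being identified with
the vector `v`. -/
def centerLattice {n : ℕ} (Γ : Subgroup (EuclIsom n)) : AddSubgroup (centerSpan Γ) where
  carrier := {v | euclTranslation (v : EuclSp n) ∈ centerIn Γ}
  zero_mem' := by
    have h : euclTranslation (0 : EuclSp n) = 1 := by ext1 x; exact zero_add x
    change euclTranslation (0 : EuclSp n) ∈ centerIn Γ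
    rw [h]
    exact one_mem _
  add_mem' := by
    intro a b ha hb
    have h : euclTranslation ((a : EuclSp n) + (b : EuclSp n)) =
        euclTranslation (a : EuclSp n) * euclTranslation (b : EuclSp n) := by
      ext1 x; exact add_assoc _ _ _
    change euclTranslation ((a : EuclSp n) + (b : EuclSp n)) ∈ centerIn Γ
    rw [h]
    exact mul_mem ha hb
  neg_mem' := by
    intro a ha
    have h : euclTranslation (-(a : EuclSp n)) = (euclTranslation (a : EuclSp n))⁻¹ := by
      ext1 x; rfl
    change euclTranslation (-(a : EuclSp n)) ∈ centerIn Γ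
    rw [h]
    exact inv_mem ha

/-- The group `V/Z(Γ)`, written multiplicatively, with the quotient topology. -/
abbrev CenterTorus {n : ℕ} (Γ : Subgroup (EuclIsom n)) : Type :=
  Multiplicative (centerSpan Γ ⧸ centerLattice Γ)

/-- The coset `Z(Γ)v` in `V/Z(Γ)`. -/
def centerCoset {n : ℕ} (Γ : Subgroup (EuclIsom n)) (v : centerSpan Γ) : CenterTorus Γ :=
  Multiplicative.ofAdd (QuotientAddGroup.mk v)

/-- The first Betti number of a finitely generated group `G`: the rank of the abelian group
`G/[G, G] = H₁(G; ℤ)`. -/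
def firstBetti (G : Type*) [Group G] : ℕ :=
  Module.finrank ℤ (Additive (Abelianization G))

/-- The topological group `T` is a torus of dimension `d`, i.e. isomorphic to `(S¹)ᵈ`. -/
def IsTorus (T : Type*) [Group T] [TopologicalSpace T] (d : ℕ) : Prop :=
  Nonempty (T ≃ₜ* (Fin d → Circle))

/-- The compact Lie group `G` has rank `r`: `r` is the largest dimension of a torus subgroup. -/
def HasLieRank (G : Type*) [Group G] [TopologicalSpace G] (r : ℕ) : Prop :=
  IsGreatest {d : ℕ | ∃ T : Subgroup G, IsTorus T d} r

end

/-! The core is a rigidity statement, `exists_orbitTranslation_eq`: an isometry of Eⁿ/Γ close to the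
identity is the translation by a short vector of V. Hence v ↦ `orbitTranslation Γ v` is a continuous
open homomorphism from V, injective near 0, with kernel Z(Γ). Its image is an open connected
subgroup, so it is the identity component, and left translates of this parametrisation are charts of
Isom(Eⁿ/Γ). Multiplication is smooth in them because conjugation by any isometry acts linearly on V
(`exists_conj_orbitTranslation`). Compactness is Arzelà–Ascoli.

For rigidity, an isometry ξ near 1 is lifted, around a point with trivial stabiliser, to a Euclidean
isometry g that is close to the identity on bounded sets. Straight segments carry the lift over a
whole Dirichlet domain. If g did not centralise Γ, a non-commuting γ of least displacement at u
would define a facet of the Dirichlet domain of u; g carries facets to facets, so gγu = δgu with δ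
in Γ (`exists_neighbour_of_not_commute`). Closeness to the identity forces δ = γ, which a generic
choice of u excludes. So g centralises Γ, and cocompactness makes it a translation
(`linPart_eq_one_of_commute`).

The dimension count rests on Bieberbach's theorem (`linPart_eq_one_of_norm_linDev_le`): the point
group is finite and the translations in Γ span Eⁿ. Summation over the point group, `pointSum`,
identifies V with its fixed vectors and yields a transfer H₁(Γ) → Z(Γ) with torsion kernel; as Z(Γ)
also embeds in H₁(Γ), both have rank β₁ = dim V. For the rank, a torus subgroup is connected, hence
lies in the identity component, and elements of order two bound its dimension. -/

/-! ### Isometries of Euclidean space and their linear parts -/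

section LinearPart

variable {n : ℕ}

/-- The linear part of an isometry of Euclidean space. -/
noncomputable def linPart (g : EuclIsom n) : EuclSp n ≃ₗᵢ[ℝ] EuclSp n :=
  g.toRealLinearIsometryEquiv

theorem linPart_apply (g : EuclIsom n) (x : EuclSp n) : linPart g x = g x - g 0 :=
  g.toRealLinearIsometryEquiv_apply x

theorem isom_apply (g : EuclIsom n) (x : EuclSp n) : g x = linPart g x + g 0 := by
  rw [linPart_apply, sub_add_cancel]

theorem isom_mul_apply (g h : EuclIsom n) (x : EuclSp n) : (g * h) x = g (h x) := rfl

theorem isom_inv_apply_self (g : EuclIsom n) (x : EuclSp n) : g⁻¹ (g x) = x :=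
  g.symm_apply_apply x

theorem isom_apply_inv_self (g : EuclIsom n) (x : EuclSp n) : g (g⁻¹ x) = x :=
  g.apply_symm_apply x

theorem isom_sub (g : EuclIsom n) (x y : EuclSp n) : g x - g y = linPart g (x - y) := by
  rw [isom_apply g x, isom_apply g y, map_sub, add_sub_add_right_eq_sub]

theorem linPart_mul_apply (g h : EuclIsom n) (x : EuclSp n) :
    linPart (g * h) x = linPart g (linPart h x) := by
  rw [linPart_apply (g * h), isom_mul_apply, isom_mul_apply, isom_sub, linPart_apply h]

theorem linPart_one : linPart (1 : EuclIsom n) = 1 := by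
  ext1 x
  rw [linPart_apply]
  exact sub_zero x

/-- Taking linear parts is a homomorphism. -/
noncomputable def linHom (n : ℕ) : EuclIsom n →* (EuclSp n ≃ₗᵢ[ℝ] EuclSp n) where
  toFun := linPart
  map_one' := linPart_one
  map_mul' g h := by ext1 x; exact linPart_mul_apply g h x

theorem linPart_mul (g h : EuclIsom n) : linPart (g * h) = linPart g * linPart h :=
  map_mul (linHom n) g h

theorem linPart_inv (g : EuclIsom n) : linPart g⁻¹ = (linPart g)⁻¹ :=
  map_inv (linHom n) g

theorem linPart_inv_apply_self (g : EuclIsom n) (x : EuclSp n) :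
    linPart g⁻¹ (linPart g x) = x := by
  rw [← linPart_mul_apply, inv_mul_cancel, linPart_one]; rfl

theorem linPart_apply_inv_self (g : EuclIsom n) (x : EuclSp n) :
    linPart g (linPart g⁻¹ x) = x := by
  rw [← linPart_mul_apply, mul_inv_cancel, linPart_one]; rfl

theorem euclTranslation_apply (a x : EuclSp n) : euclTranslation a x = a + x := rfl

theorem euclTranslation_mul (a b : EuclSp n) :
    euclTranslation a * euclTranslation b = euclTranslation (a + b) := by
  ext1 x; exact (add_assoc a b x).symm

theorem euclTranslation_injective : Function.Injective (euclTranslation (n := n)) := by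
  intro a b h
  have := congrArg (fun g : EuclIsom n => g 0) h
  simpa using this

theorem linPart_euclTranslation (a : EuclSp n) : linPart (euclTranslation a) = 1 := by
  ext1 x
  rw [linPart_apply, euclTranslation_apply, euclTranslation_apply, add_zero, add_sub_cancel_left]
  rfl

theorem eq_euclTranslation {g : EuclIsom n} (h : linPart g = 1) :
    g = euclTranslation (g 0) := by
  ext1 x
  rw [isom_apply, h, euclTranslation_apply, add_comm]; rfl

theorem conj_euclTranslation (g : EuclIsom n) (a : EuclSp n) :
    g * euclTranslation a * g⁻¹ = euclTranslation (linPart g a) := by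
  ext1 x
  rw [isom_mul_apply, isom_mul_apply, euclTranslation_apply, euclTranslation_apply, isom_apply g,
    map_add, add_assoc, ← isom_apply, isom_apply_inv_self]

/-- The deviation `A - 1` of the linear part `A` of an isometry from the identity. -/
noncomputable def linDev (g : EuclIsom n) : EuclSp n →L[ℝ] EuclSp n :=
  ((linPart g).toContinuousLinearEquiv : EuclSp n →L[ℝ] EuclSp n) - 1

theorem linDev_apply (g : EuclIsom n) (x : EuclSp n) : linDev g x = linPart g x - x := rfl

theorem linPart_eq_one_iff (g : EuclIsom n) : linPart g = 1 ↔ linDev g = 0 := by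
  constructor
  · intro h; ext1 x; rw [linDev_apply, h]; exact sub_self x
  · intro h; ext1 x
    have := linDev_apply g x
    rw [h] at this
    exact (sub_eq_zero.1 this.symm)

theorem norm_linDev_inv_mul (g h : EuclIsom n) :
    ‖linDev (g⁻¹ * h)‖ ≤ ‖linDev g - linDev h‖ := by
  refine ContinuousLinearMap.opNorm_le_bound _ (norm_nonneg _) fun x => ?_
  rw [linDev_apply, linPart_mul_apply, ← (linPart g).norm_map, map_sub, linPart_apply_inv_self,
    norm_sub_rev]
  refine le_of_eq_of_le ?_ ((linDev g - linDev h).le_opNorm x)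
  rw [sub_apply, linDev_apply, linDev_apply]
  congr 1; abel

theorem norm_linDev_mul_inv (g h : EuclIsom n) :
    ‖linDev (g * h⁻¹)‖ ≤ ‖linDev g - linDev h‖ := by
  refine ContinuousLinearMap.opNorm_le_bound _ (norm_nonneg _) fun x => ?_
  have := (linDev g - linDev h).le_opNorm (linPart h⁻¹ x)
  rw [(linPart h⁻¹).norm_map] at this
  refine le_of_eq_of_le ?_ this
  rw [sub_apply, linDev_apply, linDev_apply, linDev_apply,
    linPart_mul_apply, linPart_apply_inv_self]
  congr 1; abel

theorem norm_linDev_le (g : EuclIsom n) : ‖linDev g‖ ≤ 2 := by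
  refine ContinuousLinearMap.opNorm_le_bound _ zero_le_two fun x => ?_
  rw [linDev_apply]
  refine (norm_sub_le _ _).trans ?_
  rw [(linPart g).norm_map]; linarith

theorem isom_sub_self (g : EuclIsom n) (x : EuclSp n) : g x - x = linDev g x + g 0 := by
  rw [linDev_apply, isom_apply g x]; abel

end LinearPart

/-! ### Discrete groups of isometries -/

section Discrete

open Filter Topology

variable {n : ℕ}

/-- Small `linDev γ` and `γ 0` mean uniform closeness to the identity on compact sets. Without such
an ε, nontrivial elements of Γ would converge to 1 in the compact-open topology. -/
theorem exists_isolated (Γ : Subgroup (EuclIsom n)) [DiscreteTopology Γ] :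
    ∃ ε > 0, ∀ γ ∈ Γ, ‖linDev γ‖ < ε → ‖γ 0‖ < ε → γ = 1 := by
  by_contra! hcon
  choose u hu h1 h2 h3 using fun k : ℕ => hcon (1 / ((k : ℝ) + 1)) (by positivity)
  have hlim : Tendsto (fun k => (⟨u k, hu k⟩ : Γ)) atTop (𝓝 1) := by
    rw [tendsto_subtype_rng, nhds_induced, tendsto_comap_iff,
      ContinuousMap.tendsto_iff_forall_isCompact_tendstoUniformlyOn]
    intro K hK
    obtain ⟨M, hM⟩ := hK.isBounded.exists_norm_le
    rw [Metric.tendstoUniformlyOn_iff]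
    intro ε hε
    have ht : Tendsto (fun k : ℕ => 1 / ((k : ℝ) + 1) * (|M| + 1)) atTop (𝓝 0) := by
      simpa using (tendsto_one_div_add_atTop_nhds_zero_nat (𝕜 := ℝ)).mul_const (|M| + 1)
    filter_upwards [ht.eventually_lt_const hε] with k hk x hx
    change dist x (u k x) < ε
    rw [dist_comm, dist_eq_norm, isom_sub_self]
    have hb : ‖linDev (u k) x‖ ≤ 1 / ((k : ℝ) + 1) * |M| :=
      ((linDev (u k)).le_opNorm x).trans
        (mul_le_mul (h1 k).le ((hM x hx).trans (le_abs_self M)) (norm_nonneg _) (by positivity))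
    have := norm_add_le (linDev (u k) x) (u k 0)
    have := h2 k
    linarith
  rw [nhds_discrete, tendsto_pure] at hlim
  obtain ⟨k, hk⟩ := hlim.exists
  exact h3 k (congrArg Subtype.val hk)

/-- A bounded sequence in a proper space has a subsequence whose terms are close to each other. -/
theorem exists_close_subseq {X : Type*} [PseudoMetricSpace X] [ProperSpace X] {s : Set X}
    (hs : Bornology.IsBounded s) {x : ℕ → X} (hx : ∀ k, x k ∈ s) {ε : ℝ} (hε : 0 < ε) :
    ∃ φ : ℕ → ℕ, StrictMono φ ∧ ∀ i j, dist (x (φ i)) (x (φ j)) < ε := by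
  obtain ⟨a, -, φ, hφ, hlim⟩ := tendsto_subseq_of_bounded hs hx
  obtain ⟨N, hN⟩ := (Metric.tendsto_atTop.1 hlim) (ε / 2) (by linarith)
  refine ⟨fun i => φ (N + i), fun i j h => hφ (by omega), fun i j => ?_⟩
  have h1 : dist (x (φ (N + i))) a < ε / 2 := hN (N + i) (by omega)
  have h2 : dist (x (φ (N + j))) a < ε / 2 := hN (N + j) (by omega)
  have := dist_triangle_right (x (φ (N + i))) (x (φ (N + j))) a
  linarith

theorem exists_close_linDev (u : ℕ → EuclIsom n) {ε : ℝ} (hε : 0 < ε) :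
    ∃ φ : ℕ → ℕ, StrictMono φ ∧ ∀ i j, ‖linDev (u (φ i)) - linDev (u (φ j))‖ < ε := by
  simp only [← dist_eq_norm]
  exact exists_close_subseq (Metric.isBounded_closedBall (x := 0) (r := 2))
    (fun k => mem_closedBall_zero_iff.2 (norm_linDev_le (u k))) hε

/-- Among infinitely many isometries of bounded translation length, two are close. -/
theorem exists_close_of_bounded (u : ℕ → EuclIsom n) {R : ℝ} (hu : ∀ k, ‖u k 0‖ ≤ R)
    {ε : ℝ} (hε : 0 < ε) : ∃ φ : ℕ → ℕ, StrictMono φ ∧ ∀ i j,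
      ‖linDev (u (φ i)) - linDev (u (φ j))‖ < ε ∧ ‖u (φ i) 0 - u (φ j) 0‖ < ε := by
  obtain ⟨φ, hφ, h⟩ := exists_close_subseq (x := fun k => (linDev (u k), u k 0))
    (Metric.isBounded_closedBall (x := 0) (r := max 2 R)) (fun k => by
      rw [mem_closedBall_zero_iff, Prod.norm_def]
      exact max_le_max (norm_linDev_le _) (hu k)) hε
  refine ⟨φ, hφ, fun i j => ?_⟩
  have := h i j
  rwa [Prod.dist_eq, max_lt_iff, dist_eq_norm, dist_eq_norm] at this

/-- Among infinitely many such elements two distinct ones are close, and their quotient is then an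
element that `exists_isolated` forbids. -/
theorem finite_norm_le (Γ : Subgroup (EuclIsom n)) [DiscreteTopology Γ] (R : ℝ) :
    {γ : EuclIsom n | γ ∈ Γ ∧ ‖γ 0‖ ≤ R}.Finite := by
  by_contra hinf
  obtain ⟨ε, hε, hiso⟩ := exists_isolated Γ
  let u := Set.Infinite.natEmbedding _ hinf
  obtain ⟨φ, hφ, hc⟩ := exists_close_of_bounded (fun k => (u k : EuclIsom n))
    (fun k => (u k).2.2) hε
  have h1 : ((u (φ 0) : EuclIsom n))⁻¹ * u (φ 1) = 1 := by
    refine hiso _ (Γ.mul_mem (Γ.inv_mem (u _).2.1) (u _).2.1)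
      ((norm_linDev_inv_mul _ _).trans_lt (hc 0 1).1) ?_
    have := (hc 0 1).2
    have e : ((u (φ 0) : EuclIsom n)⁻¹ * u (φ 1)) 0 =
        linPart (u (φ 0) : EuclIsom n)⁻¹ ((u (φ 1) : EuclIsom n) 0 - (u (φ 0) : EuclIsom n) 0) := by
      rw [← isom_sub, isom_inv_apply_self, sub_zero, isom_mul_apply]
    rw [e, LinearIsometryEquiv.norm_map, norm_sub_rev]
    exact this
  have h2 : u (φ 0) = u (φ 1) := Subtype.ext (inv_mul_eq_one.1 h1)
  exact (hφ zero_lt_one).ne (u.injective h2)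

theorem finite_dist_le (Γ : Subgroup (EuclIsom n)) [DiscreteTopology Γ] (x y : EuclSp n) (R : ℝ) :
    {γ : EuclIsom n | γ ∈ Γ ∧ dist x (γ y) ≤ R}.Finite := by
  refine (finite_norm_le Γ (R + ‖x‖ + ‖y‖)).subset fun γ hγ => ⟨hγ.1, ?_⟩
  have h1 : dist (γ y) (γ 0) = dist y 0 := γ.dist_eq y 0
  have h2 := dist_triangle (γ 0) (γ y) 0
  have h3 := dist_triangle (γ y) x 0
  have h4 := hγ.2
  rw [dist_comm x (γ y)] at h4
  rw [dist_comm (γ 0) (γ y), h1] at h2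
  simp only [dist_zero_right] at *
  linarith

theorem countable_of_discrete (Γ : Subgroup (EuclIsom n)) [DiscreteTopology Γ] :
    (Γ : Set (EuclIsom n)).Countable := by
  have : (Γ : Set (EuclIsom n)) = ⋃ k : ℕ, {γ : EuclIsom n | γ ∈ Γ ∧ ‖γ 0‖ ≤ k} := by
    ext γ
    simp only [Set.mem_iUnion, Set.mem_ofPred_eq, SetLike.mem_coe]
    exact ⟨fun h => (exists_nat_ge ‖γ 0‖).imp fun k hk => ⟨h, hk⟩, fun ⟨k, h, _⟩ => h⟩
  rw [this]
  exact Set.countable_iUnion fun k => (finite_norm_le Γ k).countable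

end Discrete

/-! ### The orbit space -/

section OrbitSpace

variable {n : ℕ} (Γ : Subgroup (EuclIsom n))

theorem orbitPt_surjective : Function.Surjective (orbitPt Γ) := Quotient.mk_surjective

theorem orbitPt_eq_iff {x y : EuclSp n} : orbitPt Γ x = orbitPt Γ y ↔ ∃ γ ∈ Γ, γ y = x := by
  refine Quotient.eq.trans ⟨?_, ?_⟩
  · rintro ⟨γ, h⟩; exact ⟨γ, γ.2, h⟩
  · rintro ⟨γ, hγ, h⟩; exact ⟨⟨γ, hγ⟩, h⟩

theorem orbitPt_smul {γ : EuclIsom n} (hγ : γ ∈ Γ) (x : EuclSp n) :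
    orbitPt Γ (γ x) = orbitPt Γ x := (orbitPt_eq_iff Γ).2 ⟨γ, hγ, rfl⟩

theorem dist_orbitPt (x y : EuclSp n) :
    dist (orbitPt Γ x) (orbitPt Γ y) = preOrbitDist Γ x y := rfl

theorem dist_orbitPt_le (x y : EuclSp n) : dist (orbitPt Γ x) (orbitPt Γ y) ≤ dist x y := by
  exact preOrbitDist_le Γ x y 1

theorem dist_orbitPt_le_smul (x y : EuclSp n) {γ : EuclIsom n} (hγ : γ ∈ Γ) :
    dist (orbitPt Γ x) (orbitPt Γ y) ≤ dist x (γ y) := preOrbitDist_le Γ x y ⟨γ, hγ⟩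

theorem dist_orbitPt_lt_iff (x y : EuclSp n) (r : ℝ) :
    dist (orbitPt Γ x) (orbitPt Γ y) < r ↔ ∃ γ ∈ Γ, dist x (γ y) < r := by
  rw [dist_orbitPt, preOrbitDist_lt_iff]
  exact ⟨fun ⟨γ, h⟩ => ⟨γ, γ.2, h⟩, fun ⟨γ, hγ, h⟩ => ⟨⟨γ, hγ⟩, h⟩⟩

theorem le_dist_orbitPt {x y : EuclSp n} {r : ℝ} (h : ∀ γ ∈ Γ, r ≤ dist x (γ y)) :
    r ≤ dist (orbitPt Γ x) (orbitPt Γ y) := by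
  by_contra! hlt
  obtain ⟨γ, hγ, h'⟩ := (dist_orbitPt_lt_iff Γ x y r).1 hlt
  exact (h γ hγ).not_gt h'

theorem exists_dist_orbitPt_eq [DiscreteTopology Γ] (x y : EuclSp n) :
    ∃ γ ∈ Γ, dist x (γ y) = dist (orbitPt Γ x) (orbitPt Γ y) := by
  set s := {γ : EuclIsom n | γ ∈ Γ ∧ dist x (γ y) ≤ dist x y}
  obtain ⟨γ, hγ, hmin⟩ := (finite_dist_le Γ x y (dist x y)).exists_minimalFor
    (fun γ : EuclIsom n => dist x (γ y)) s ⟨1, Γ.one_mem, le_rfl⟩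
  refine ⟨γ, hγ.1, le_antisymm (le_dist_orbitPt Γ fun δ hδ => ?_) (dist_orbitPt_le_smul Γ x y hγ.1)⟩
  by_cases hle : dist x (δ y) ≤ dist x y
  · rcases le_total (dist x (γ y)) (dist x (δ y)) with h | h
    · exact h
    · exact hmin ⟨hδ, hle⟩ h
  · exact hγ.2.trans (not_le.1 hle).le

theorem exists_orbitPt_eq_dist_eq [DiscreteTopology Γ] (x : EuclSp n) (q : OrbitSp Γ) :
    ∃ y, orbitPt Γ y = q ∧ dist x y = dist (orbitPt Γ x) q := by
  obtain ⟨y, rfl⟩ := orbitPt_surjective Γ q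
  obtain ⟨γ, hγ, h⟩ := exists_dist_orbitPt_eq Γ x y
  exact ⟨γ y, orbitPt_smul Γ hγ y, h⟩

theorem orbitSp_eq_of_dist_eq_zero [DiscreteTopology Γ] {p q : OrbitSp Γ} (h : dist p q = 0) :
    p = q := by
  obtain ⟨x, rfl⟩ := orbitPt_surjective Γ p
  obtain ⟨y, rfl, hy⟩ := exists_orbitPt_eq_dist_eq Γ x q
  rw [h, dist_eq_zero] at hy
  rw [hy]

theorem t2Space_orbitSp [DiscreteTopology Γ] : T2Space (OrbitSp Γ) := by
  have : T0Space (OrbitSp Γ) := by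
    refine ⟨fun x y h => orbitSp_eq_of_dist_eq_zero Γ ?_⟩
    exact Metric.inseparable_iff.1 h
  infer_instance

theorem exists_codiameter [CompactSpace (OrbitSp Γ)] :
    ∃ c > 0, ∀ p q : OrbitSp Γ, dist p q < c := by
  obtain ⟨c, hc⟩ := Metric.isBounded_iff.1 (isCompact_univ (X := OrbitSp Γ)).isBounded
  refine ⟨|c| + 1, by positivity, fun p q => ?_⟩
  have := hc (Set.mem_univ p) (Set.mem_univ q)
  have := le_abs_self c
  linarith

end OrbitSpace

/-- All points of the orbit of 0 are moved by g through the same distance, and every point is within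
c of that orbit, so the displacement of g is bounded. A linear map with bounded image is zero. -/
theorem linPart_eq_one_of_commute {n : ℕ} (Γ : Subgroup (EuclIsom n)) [CompactSpace (OrbitSp Γ)]
    {g : EuclIsom n} (hg : ∀ γ ∈ Γ, g * γ = γ * g) : linPart g = 1 := by
  obtain ⟨c, hc, hdiam⟩ := exists_codiameter Γ
  have hbd : ∀ x : EuclSp n, ‖linDev g x‖ ≤ 2 * (c + c + ‖g 0‖) := by
    intro x
    obtain ⟨γ, hγ, hx⟩ := (dist_orbitPt_lt_iff Γ x 0 c).1 (hdiam _ _)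
    have e : dist (g (γ 0)) (γ 0) = ‖g 0‖ := by
      rw [← isom_mul_apply, hg γ hγ, isom_mul_apply, γ.dist_eq, dist_zero_right]
    have h1 : ‖g x - x‖ ≤ c + ‖g 0‖ + c := by
      rw [← dist_eq_norm]
      have := dist_triangle4 (g x) (g (γ 0)) (γ 0) x
      rw [e, g.dist_eq, dist_comm (γ 0)] at this
      linarith
    have h2 : linDev g x = (g x - x) - g 0 := by rw [isom_sub_self]; abel
    rw [h2]
    have := norm_sub_le (g x - x) (g 0)
    have := norm_nonneg (g 0)
    linarith
  rw [linPart_eq_one_iff]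
  ext1 x
  by_contra hx
  have hx' : 0 < ‖linDev g x‖ := norm_pos_iff.2 hx
  obtain ⟨k, hk⟩ := exists_nat_gt (2 * (c + c + ‖g 0‖) / ‖linDev g x‖)
  have := hbd ((k : ℝ) • x)
  rw [map_smul, norm_smul, Real.norm_natCast] at this
  rw [div_lt_iff₀ hx'] at hk
  linarith

/-! ### Bieberbach's theorem -/

section Bieberbach

open scoped InnerProductSpace commutatorElement

variable {n : ℕ}

/-- Cocompactness gives elements carrying 0 to within c of k • u for every k. Infinitely many of
them have nearly equal linear parts; dividing by a fixed one cancels the rotation and shifts the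
translation part by a bounded amount. -/
theorem exists_long_nearly_translation (Γ : Subgroup (EuclIsom n)) [CompactSpace (OrbitSp Γ)]
    (u : EuclSp n) {ε : ℝ} (hε : 0 < ε) :
    ∃ C : ℝ, ∀ K₀ : ℝ, ∃ K ≥ K₀, ∃ β ∈ Γ, ‖linDev β‖ < ε ∧ ‖β 0 - K • u‖ ≤ C := by
  obtain ⟨c, hc, hdiam⟩ := exists_codiameter Γ
  choose b hb hbd using fun k : ℕ => (dist_orbitPt_lt_iff Γ ((k : ℝ) • u) 0 c).1 (hdiam _ _)
  obtain ⟨φ, hφ, h⟩ := exists_close_linDev b hε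
  refine ⟨‖(b (φ 0))⁻¹ 0‖ + c, fun K₀ => ?_⟩
  obtain ⟨j, hj⟩ := exists_nat_ge K₀
  refine ⟨φ j, hj.trans (by exact_mod_cast hφ.le_apply), b (φ j) * (b (φ 0))⁻¹,
    Γ.mul_mem (hb _) (Γ.inv_mem (hb _)), (norm_linDev_mul_inv _ _).trans_lt (h j 0), ?_⟩
  rw [isom_mul_apply, isom_apply, add_sub_assoc]
  refine (norm_add_le _ _).trans (add_le_add ((linPart _).norm_map _).le ?_)
  rw [norm_sub_rev, ← dist_eq_norm]
  exact (hbd (φ j)).le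

/-- As A is orthogonal, the adjoint of A - 1 is A⁻¹ - 1; the two commute, so `linDev g` is normal.
-/
theorem inner_linDev (g : EuclIsom n) (x y : EuclSp n) :
    ⟪linDev g x, y⟫_ℝ = ⟪x, linDev g⁻¹ y⟫_ℝ := by
  rw [linDev_apply, linDev_apply, inner_sub_left, inner_sub_right,
    ← (linPart g⁻¹).inner_map_map (linPart g x) y, linPart_inv_apply_self]

theorem linDev_inv_comm (g : EuclIsom n) (x : EuclSp n) :
    linDev g⁻¹ (linDev g x) = linDev g (linDev g⁻¹ x) := by
  simp only [linDev_apply, map_sub, linPart_inv_apply_self, linPart_apply_inv_self]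
  abel

theorem norm_linDev_inv_apply (g : EuclIsom n) (x : EuclSp n) :
    ‖linDev g⁻¹ x‖ = ‖linDev g x‖ := by
  rw [linDev_apply, linDev_apply, ← (linPart g).norm_map, map_sub, linPart_apply_inv_self,
    norm_sub_rev]

theorem exists_norm_max {F : Type*} [NormedAddCommGroup F] [NormedSpace ℝ F]
    [FiniteDimensional ℝ F] (T : F →L[ℝ] F) (W : Submodule ℝ F) (hW : W ≠ ⊥) :
    ∃ x ∈ W, ‖x‖ = 1 ∧ ∀ y ∈ W, ‖T y‖ ≤ ‖T x‖ * ‖y‖ := by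
  have : ProperSpace F := FiniteDimensional.proper ℝ F
  obtain ⟨w, hw, hw0⟩ := W.ne_bot_iff.1 hW
  have hK : IsCompact (Metric.sphere (0 : F) 1 ∩ W) :=
    (isCompact_sphere _ _).inter_right W.closed_of_finiteDimensional
  have hne : (Metric.sphere (0 : F) 1 ∩ W).Nonempty := by
    refine ⟨‖w‖⁻¹ • w, ?_, W.smul_mem _ hw⟩
    rw [mem_sphere_zero_iff_norm, norm_smul, norm_inv, norm_norm,
      inv_mul_cancel₀ (norm_ne_zero_iff.2 hw0)]
  obtain ⟨x, ⟨hx1, hx2⟩, hmax⟩ := hK.exists_isMaxOn hne (f := fun y => ‖T y‖) (by fun_prop)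
  refine ⟨x, hx2, mem_sphere_zero_iff_norm.1 hx1, fun y hy => ?_⟩
  rcases eq_or_ne y 0 with rfl | hy0
  · simp
  have hpos := norm_pos_iff.2 hy0
  have h1 : ‖T (‖y‖⁻¹ • y)‖ ≤ ‖T x‖ := hmax ⟨by
    rw [mem_sphere_zero_iff_norm, norm_smul, norm_inv, norm_norm, inv_mul_cancel₀ hpos.ne'],
    W.smul_mem _ hy⟩
  rw [map_smul, norm_smul, norm_inv, norm_norm, inv_mul_le_iff₀ hpos] at h1
  linarith

/-- The space of vectors turned most by the linear part of `g`, and its orthogonal complement. -/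
theorem exists_top_subspace (g : EuclIsom n) (hg : linDev g ≠ 0) :
    ∃ (U : Submodule ℝ (EuclSp n)) (m' : ℝ), 0 ≤ m' ∧ m' < ‖linDev g‖ ∧ U ≠ ⊥ ∧
      (∀ x ∈ U, ‖linDev g x‖ = ‖linDev g‖ * ‖x‖ ∧ linDev g x ∈ U) ∧
      ∀ x ∈ Uᗮ, ‖linDev g x‖ ≤ m' * ‖x‖ ∧ linDev g x ∈ Uᗮ := by
  set m := ‖linDev g‖ with hm
  have hmpos : 0 < m := norm_pos_iff.2 hg
  -- With T = `linDev g`, this is the eigenspace of T*T for its top eigenvalue m². Normality of T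
  -- makes both U and its orthogonal complement invariant.
  let U : Submodule ℝ (EuclSp n) :=
    LinearMap.ker ((linDev g⁻¹ ∘L linDev g - (m ^ 2) • ContinuousLinearMap.id ℝ (EuclSp n) :
      EuclSp n →L[ℝ] EuclSp n) : EuclSp n →ₗ[ℝ] EuclSp n)
  have hU : ∀ x, x ∈ U ↔ linDev g⁻¹ (linDev g x) = m ^ 2 • x := fun x => by
    simp [U, sub_eq_zero]
  -- Expanding ‖T*T x - m² x‖² with ‖T x‖ = m ‖x‖ leaves ‖T*T x‖² - m⁴ ‖x‖², which is at most 0.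
  have hmax : ∀ x, ‖linDev g x‖ = m * ‖x‖ → x ∈ U := by
    intro x hx
    rw [hU, ← sub_eq_zero, ← norm_eq_zero, ← sq_eq_zero_iff]
    refine le_antisymm ?_ (sq_nonneg _)
    rw [norm_sub_sq_real, inner_smul_right, real_inner_comm, ← inner_linDev,
      real_inner_self_eq_norm_sq, hx, norm_linDev_inv_apply, norm_smul]
    have h1 : ‖linDev g (linDev g x)‖ ≤ m * (m * ‖x‖) := hx ▸ (linDev g).le_opNorm _
    have h2 := pow_le_pow_left₀ (norm_nonneg _) h1 2
    simp only [norm_pow, Real.norm_eq_abs, abs_of_pos hmpos]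
    nlinarith
  have hUnorm : ∀ x ∈ U, ‖linDev g x‖ = m * ‖x‖ := by
    intro x hx
    rw [← sq_eq_sq₀ (norm_nonneg _) (by positivity), ← real_inner_self_eq_norm_sq, inner_linDev,
      (hU x).1 hx, inner_smul_right, real_inner_self_eq_norm_sq]
    ring
  have hUinv : ∀ x ∈ U, linDev g x ∈ U := by
    intro x hx
    rw [hU, linDev_inv_comm, (hU x).1 hx, map_smul]
  have hUinv' : ∀ x ∈ U, linDev g⁻¹ x ∈ U := by
    intro x hx
    rw [hU, ← linDev_inv_comm, (hU x).1 hx, map_smul]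
  have hperp : ∀ x ∈ Uᗮ, linDev g x ∈ Uᗮ := by
    intro x hx
    rw [Submodule.mem_orthogonal'] at hx ⊢
    intro u hu
    rw [inner_linDev]
    exact hx _ (hUinv' u hu)
  have hU0 : U ≠ ⊥ := by
    have htop : (⊤ : Submodule ℝ (EuclSp n)) ≠ ⊥ := by
      intro h
      apply hg
      ext1 x
      have : x ∈ (⊥ : Submodule ℝ (EuclSp n)) := h ▸ Submodule.mem_top
      rw [(Submodule.mem_bot ℝ).1 this, map_zero, map_zero]
    obtain ⟨x, -, hx1, hx2⟩ := exists_norm_max (linDev g) ⊤ htop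
    have hle : m ≤ ‖linDev g x‖ := (linDev g).opNorm_le_bound (norm_nonneg _)
      fun y => hx2 y Submodule.mem_top
    have hge : ‖linDev g x‖ ≤ m * ‖x‖ := (linDev g).le_opNorm x
    have hxU := hmax x (le_antisymm hge (by rw [hx1, mul_one]; exact hle))
    intro h
    rw [h, Submodule.mem_bot] at hxU
    rw [hxU, norm_zero] at hx1
    exact zero_ne_one hx1
  by_cases hbot : Uᗮ = ⊥
  · refine ⟨U, 0, le_rfl, hmpos, hU0, fun x hx => ⟨hUnorm x hx, hUinv x hx⟩, fun x hx =>
      ⟨?_, hperp x hx⟩⟩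
    rw [hbot, Submodule.mem_bot] at hx
    simp [hx]
  · obtain ⟨x, hx0, hx1, hx2⟩ := exists_norm_max (linDev g) Uᗮ hbot
    refine ⟨U, ‖linDev g x‖, norm_nonneg _, ?_, hU0, fun x hx => ⟨hUnorm x hx, hUinv x hx⟩,
      fun y hy => ⟨hx2 y hy, hperp y hy⟩⟩
    have hge : ‖linDev g x‖ ≤ m * ‖x‖ := (linDev g).le_opNorm x
    refine lt_of_le_of_ne (by rwa [hx1, mul_one] at hge) fun heq => ?_
    have hxU := hmax x (by rw [hx1, mul_one]; exact heq)
    have : ⟪x, x⟫_ℝ = 0 := (U.mem_orthogonal x).1 hx0 x hxU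
    rw [inner_self_eq_zero.1 this, norm_zero] at hx1
    exact zero_ne_one hx1

theorem norm_le_norm_add_orthogonal {U : Submodule ℝ (EuclSp n)} {e f : EuclSp n} (he : e ∈ U)
    (hf : f ∈ Uᗮ) : ‖e‖ ≤ ‖e + f‖ ∧ ‖f‖ ≤ ‖e + f‖ := by
  have h0 : ⟪e, f⟫_ℝ = 0 := (U.mem_orthogonal f).1 hf e he
  have h := norm_add_sq_real e f
  rw [h0] at h
  constructor <;> refine abs_le_of_sq_le_sq' (a := _) ?_ (norm_nonneg _) |>.2 <;>
    nlinarith [sq_nonneg ‖e‖, sq_nonneg ‖f‖]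

/-- AB - BA = (A - 1)(B - 1) - (B - 1)(A - 1) is quadratic in the deviations. -/
theorem norm_linDev_commutator (g h : EuclIsom n) :
    ‖linDev ⁅g, h⁆‖ ≤ 2 * ‖linDev g‖ * ‖linDev h‖ := by
  refine ContinuousLinearMap.opNorm_le_bound _ (by positivity) fun x => ?_
  obtain ⟨y, rfl⟩ : ∃ y, linPart (h * g) y = x := (linPart (h * g)).surjective x
  rw [(linPart (h * g)).norm_map, linDev_apply, ← linPart_mul_apply,
    show ⁅g, h⁆ * (h * g) = g * h by rw [commutatorElement_def]; group]
  have e : linPart (g * h) y - linPart (h * g) y =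
      linDev g (linDev h y) - linDev h (linDev g y) := by
    simp only [linPart_mul_apply, linDev_apply, map_sub]; abel
  rw [e]
  have h1 := (linDev g).le_opNorm_of_le ((linDev h).le_opNorm y)
  have h2 := (linDev h).le_opNorm_of_le ((linDev g).le_opNorm y)
  have := norm_sub_le (linDev g (linDev h y)) (linDev h (linDev g y))
  linarith

/-- Comparing the two sides of [g, h] h g = g h at 0 shows that, when h is nearly a translation, the
commutator translates approximately by `linDev g (h 0)`. -/
theorem norm_commutator_apply_zero (g h : EuclIsom n) :
    ‖⁅g, h⁆ 0 - linDev g (h 0)‖ ≤ ‖linDev ⁅g, h⁆‖ * ‖h 0‖ + ‖linDev h‖ * ‖g 0‖ := by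
  have key : ⁅g, h⁆ 0 - linDev g (h 0) =
      -linDev ⁅g, h⁆ (h 0) - linPart g (linDev h (linPart g⁻¹ (g 0))) := by
    have h1 : ⁅g, h⁆ (h (g 0)) = g (h 0) := by
      rw [← isom_mul_apply h, ← isom_mul_apply, ← isom_mul_apply g,
        show ⁅g, h⁆ * (h * g) = g * h by rw [commutatorElement_def]; group]
    rw [isom_apply ⁅g, h⁆, isom_apply h (g 0), isom_apply g (h 0), map_add] at h1
    have h2 : linPart ⁅g, h⁆ (linPart h (g 0)) = linPart g (linPart h (linPart g⁻¹ (g 0))) := by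
      simp only [← linPart_mul_apply]
      congr 2
      rw [commutatorElement_def]; group
    rw [h2] at h1
    simp only [linDev_apply, map_sub, linPart_apply_inv_self]
    rw [eq_sub_of_add_eq' h1]
    abel
  rw [key]
  refine (norm_sub_le _ _).trans (add_le_add ?_ ?_)
  · rw [norm_neg]; exact (linDev _).le_opNorm _
  · rw [(linPart g).norm_map]
    refine ((linDev h).le_opNorm _).trans ?_
    rw [(linPart _).norm_map]

theorem exists_minimal_norm (Γ : Subgroup (EuclIsom n)) [DiscreteTopology Γ]
    {p : EuclIsom n → Prop} (hp : ∃ γ ∈ Γ, p γ) :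
    ∃ γ ∈ Γ, p γ ∧ ∀ δ ∈ Γ, p δ → ‖γ 0‖ ≤ ‖δ 0‖ := by
  obtain ⟨γ₀, h1, h2⟩ := hp
  obtain ⟨γ, ⟨⟨hγ, hγ'⟩, hp⟩, hmin⟩ :=
    ((finite_norm_le Γ ‖γ₀ 0‖).inter_of_left {γ | p γ}).exists_minimalFor
    (fun γ : EuclIsom n => ‖γ 0‖) _ ⟨γ₀, ⟨h1, le_rfl⟩, h2⟩
  refine ⟨γ, hγ, hp, fun δ hδ hpδ => ?_⟩
  by_cases hle : ‖δ 0‖ ≤ ‖γ₀ 0‖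
  · rcases le_total ‖γ 0‖ ‖δ 0‖ with h | h
    · exact h
    · exact hmin ⟨⟨hδ, hle⟩, hpδ⟩ h
  · exact hγ'.trans (not_le.1 hle).le

/-- In a space group, an element whose linear part is close to the identity is a translation. -/
theorem linPart_eq_one_of_norm_linDev_le (Γ : Subgroup (EuclIsom n)) [DiscreteTopology Γ]
    [CompactSpace (OrbitSp Γ)] {γ : EuclIsom n} (hγ : γ ∈ Γ) (hle : ‖linDev γ‖ ≤ 1 / 2) :
    linPart γ = 1 := by
  by_contra hne
  rw [linPart_eq_one_iff] at hne
  obtain ⟨α, hα, ⟨hα1, hα2⟩, hαmin⟩ := exists_minimal_norm Γ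
    (p := fun α => ‖linDev α‖ ≤ 1 / 2 ∧ linDev α ≠ 0) ⟨γ, hγ, hle, hne⟩
  obtain ⟨U, m', hm'0, hm', hU0, hU, hU'⟩ := exists_top_subspace α hα2
  set m := ‖linDev α‖ with hm
  -- Such a β is nearly a translation, mostly in the directions turned most by α. Commutation with α
  -- preserves Q and shortens the translation part, which a shortest β rules out. The factor 16
  -- keeps the error r below (m - m') / 4 * ‖e‖.
  let Q : EuclIsom n → Prop := fun β => ‖linDev β‖ ≤ (m - m') / 16 ∧
    ∃ e ∈ U, ∃ f ∈ Uᗮ, β 0 = e + f ∧ ‖f‖ ≤ ‖e‖ ∧ 0 < ‖e‖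
  have hQ : ∃ β ∈ Γ, Q β := by
    obtain ⟨u, hu, hu1, -⟩ := exists_norm_max (linDev α) U hU0
    obtain ⟨C, hC⟩ := exists_long_nearly_translation Γ u (ε := (m - m') / 16) (by linarith)
    obtain ⟨K, hK, β, hβ, hβ1, hβ2⟩ := hC (|C| + |C| + 1)
    obtain ⟨y, hy, z, hz, hyz⟩ := U.exists_add_mem_mem_orthogonal (β 0 - K • u)
    have hK0 : 0 ≤ K := by linarith [abs_nonneg C]
    obtain ⟨h1, h2⟩ := norm_le_norm_add_orthogonal hy hz
    rw [← hyz] at h1 h2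
    have h3 : K - ‖y‖ ≤ ‖K • u + y‖ := by
      have := norm_sub_le (K • u + y) y
      rw [add_sub_cancel_right, norm_smul, hu1, mul_one, Real.norm_eq_abs, abs_of_nonneg hK0]
        at this
      linarith
    have := le_abs_self C
    refine ⟨β, hβ, hβ1.le, K • u + y, U.add_mem (U.smul_mem _ hu) hy, z, hz, ?_, ?_, ?_⟩
    · rw [add_assoc, ← hyz]; abel
    · linarith
    · linarith [abs_nonneg C]
  obtain ⟨β, hβ, ⟨hβ1, e, he, f, hf, hb, hfe, he0⟩, hβmin⟩ := exists_minimal_norm Γ hQ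
  obtain ⟨y, hy, z, hz, hyz⟩ := U.exists_add_mem_mem_orthogonal (⁅α, β⁆ 0 - linDev α (β 0))
  obtain ⟨h1, h2⟩ := norm_le_norm_add_orthogonal hy hz
  obtain ⟨h3, h4⟩ := norm_le_norm_add_orthogonal he hf
  rw [← hyz] at h1 h2
  rw [← hb] at h3 h4
  have hbe : ‖β 0‖ ≤ 2 * ‖e‖ := by rw [hb]; linarith [norm_add_le e f]
  have hcomm := norm_linDev_commutator α β
  have hr := norm_commutator_apply_zero α β
  set r := ⁅α, β⁆ 0 - linDev α (β 0) with hrdef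
  have hβ0 := norm_nonneg (linDev β)
  have hb0 := norm_nonneg (β 0)
  have hdev : ‖linDev ⁅α, β⁆‖ ≤ ‖linDev β‖ := by
    refine hcomm.trans ?_
    rw [← hm]
    nlinarith
  -- If β has a nontrivial linear part, it competes with α in the choice of α, so `‖α 0‖ ≤ ‖β 0‖`;
  -- otherwise both sides vanish.
  have hβa : ‖linDev β‖ * ‖α 0‖ ≤ ‖linDev β‖ * ‖β 0‖ := by
    rcases eq_or_ne (linDev β) 0 with h | h
    · rw [h, norm_zero, zero_mul, zero_mul]
    · exact mul_le_mul_of_nonneg_left (hαmin β hβ ⟨by linarith, h⟩) hβ0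
  have hr1 : ‖r‖ ≤ (m - m') / 8 * ‖β 0‖ := by nlinarith
  have hr2 : ‖r‖ ≤ (m - m') / 4 * ‖e‖ := by nlinarith
  have hmm : 0 < (m - m') * ‖e‖ := mul_pos (by linarith) he0
  have hc0 : ⁅α, β⁆ 0 = (linDev α e + y) + (linDev α f + z) := by
    have : ⁅α, β⁆ 0 = linDev α (β 0) + r := by rw [hrdef]; abel
    rw [this, hyz, hb, map_add]; abel
  have he' : m * ‖e‖ - ‖r‖ ≤ ‖linDev α e + y‖ := by
    have := norm_sub_le (linDev α e + y) y
    rw [add_sub_cancel_right, (hU e he).1] at this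
    linarith
  have hf' : ‖linDev α f + z‖ ≤ m' * ‖e‖ + ‖r‖ := by
    have h5 := norm_add_le (linDev α f) z
    have h6 := (hU' f hf).1
    have h7 := mul_le_mul_of_nonneg_left hfe hm'0
    linarith
  -- The component in U stays dominant: m ‖e‖ exceeds m' ‖e‖ by more than 2 ‖r‖.
  have hmin := hβmin ⁅α, β⁆ (by
      rw [commutatorElement_def]
      exact Γ.mul_mem (Γ.mul_mem (Γ.mul_mem hα hβ) (Γ.inv_mem hα)) (Γ.inv_mem hβ))
    ⟨hdev.trans hβ1, linDev α e + y, U.add_mem (hU e he).2 hy, linDev α f + z,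
      Uᗮ.add_mem (hU' f hf).2 hz, hc0, by linarith, by nlinarith⟩
  -- As m ≤ 1/2 and ‖r‖ is at most a sixteenth of `‖β 0‖`, the commutator is strictly shorter than
  -- β.
  have h8 : ‖⁅α, β⁆ 0‖ ≤ m * ‖β 0‖ + ‖r‖ := by
    have : ⁅α, β⁆ 0 = linDev α (β 0) + r := by rw [hrdef]; abel
    rw [this]
    exact (norm_add_le _ _).trans (add_le_add ((linDev α).le_opNorm _) le_rfl)
  nlinarith

end Bieberbach

/-! ### Finiteness of the point group and the span of the translations -/

section PointGroup

variable {n : ℕ} (Γ : Subgroup (EuclIsom n))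

/-- The group of linear parts of the elements of `Γ`. -/
noncomputable def pointGroup : Subgroup (EuclSp n ≃ₗᵢ[ℝ] EuclSp n) := Γ.map (linHom n)

theorem linPart_mem_pointGroup {γ : EuclIsom n} (hγ : γ ∈ Γ) : linPart γ ∈ pointGroup Γ :=
  Subgroup.mem_map_of_mem (linHom n) hγ

variable [DiscreteTopology Γ] [CompactSpace (OrbitSp Γ)]

/-- Otherwise two distinct linear parts would be within 1/2 of each other, and their quotient would
contradict Bieberbach's theorem. -/
theorem finite_pointGroup : Finite (pointGroup Γ) := by
  by_contra hinf
  rw [not_finite_iff_infinite] at hinf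
  let u := Infinite.natEmbedding (pointGroup Γ)
  choose g hg hgu using fun k => (u k).2
  obtain ⟨φ, hφ, h⟩ := exists_close_linDev g (ε := 1 / 2) (by norm_num)
  have h1 : linPart ((g (φ 0))⁻¹ * g (φ 1)) = 1 :=
    linPart_eq_one_of_norm_linDev_le Γ (Γ.mul_mem (Γ.inv_mem (hg _)) (hg _))
      ((norm_linDev_inv_mul _ _).trans (h 0 1).le)
  rw [linPart_mul, linPart_inv, inv_mul_eq_one] at h1
  have h2 : u (φ 0) = u (φ 1) := Subtype.ext ((hgu _).symm.trans (h1.trans (hgu _)))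
  exact (hφ zero_lt_one).ne (u.injective h2)

/-- A long, nearly translational element in a direction u orthogonal to the span is a genuine
translation, so its vector lies in the span and is at distance at least K from K • u. This exceeds
the allowed error C. -/
theorem translationSpan_eq_top : translationSpan Γ = ⊤ := by
  by_contra hne
  have hperp : (translationSpan Γ)ᗮ ≠ ⊥ := fun h => hne (Submodule.orthogonal_eq_bot_iff.1 h)
  obtain ⟨u, hu, hu1, -⟩ := exists_norm_max (0 : EuclSp n →L[ℝ] EuclSp n) _ hperp
  obtain ⟨C, hC⟩ := exists_long_nearly_translation Γ u (ε := 1 / 2) (by norm_num)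
  obtain ⟨K, hK, β, hβ, hβ1, hβ2⟩ := hC (|C| + 1)
  have ht : β = euclTranslation (β 0) :=
    eq_euclTranslation (linPart_eq_one_of_norm_linDev_le Γ hβ hβ1.le)
  have hmem : β 0 ∈ translationSpan Γ := Submodule.subset_span (by
    change euclTranslation (β 0) ∈ Γ
    rwa [← ht])
  have h1 := (norm_le_norm_add_orthogonal hmem
    ((translationSpan Γ)ᗮ.neg_mem ((translationSpan Γ)ᗮ.smul_mem K hu))).2
  rw [norm_neg, norm_smul, hu1, mul_one, ← sub_eq_add_neg, Real.norm_eq_abs] at h1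
  have := le_abs_self C
  have := le_abs_self K
  linarith

end PointGroup

/-! ### The center and its span -/

section Center

variable {n : ℕ} (Γ : Subgroup (EuclIsom n))

theorem mem_centerIn {g : EuclIsom n} : g ∈ centerIn Γ ↔ g ∈ Γ ∧ ∀ γ ∈ Γ, γ * g = g * γ := by
  simp only [centerIn, Subgroup.mem_map, Subgroup.mem_center_iff]
  constructor
  · rintro ⟨x, hx, rfl⟩
    exact ⟨x.2, fun γ hγ => congrArg Subtype.val (hx ⟨γ, hγ⟩)⟩
  · rintro ⟨h1, h2⟩
    exact ⟨⟨g, h1⟩, fun γ => Subtype.ext (h2 γ γ.2), rfl⟩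

theorem commute_euclTranslation_iff (g : EuclIsom n) (a : EuclSp n) :
    g * euclTranslation a = euclTranslation a * g ↔ linPart g a = a := by
  rw [← euclTranslation_injective.eq_iff, ← conj_euclTranslation, mul_inv_eq_iff_eq_mul]

theorem euclTranslation_mem_centerIn {a : EuclSp n} :
    euclTranslation a ∈ centerIn Γ ↔ euclTranslation a ∈ Γ ∧ ∀ γ ∈ Γ, linPart γ a = a := by
  simp only [mem_centerIn, commute_euclTranslation_iff]

theorem linPart_of_mem_centerSpan {a : EuclSp n} (ha : a ∈ centerSpan Γ) {γ : EuclIsom n}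
    (hγ : γ ∈ Γ) : linPart γ a = a := by
  induction ha using Submodule.span_induction with
  | mem x hx => exact ((euclTranslation_mem_centerIn Γ).1 hx).2 γ hγ
  | zero => exact map_zero _
  | add x y _ _ hx hy => rw [map_add, hx, hy]
  | smul c x _ hx => rw [map_smul, hx]

theorem centerIn_eq_translation [CompactSpace (OrbitSp Γ)] {g : EuclIsom n}
    (hg : g ∈ centerIn Γ) : ∃ v : centerSpan Γ, g = euclTranslation (v : EuclSp n) := by
  have h := eq_euclTranslation (linPart_eq_one_of_commute Γ
    fun γ hγ => (((mem_centerIn Γ).1 hg).2 γ hγ).symm)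
  refine ⟨⟨g 0, Submodule.subset_span ?_⟩, h⟩
  change euclTranslation (g 0) ∈ centerIn Γ
  rwa [← h]

/-- The sum of all the images of a vector under the (finite) point group. -/
noncomputable def pointSum : EuclSp n →ₗ[ℝ] EuclSp n :=
  ∑ᶠ A : pointGroup Γ, ((A : EuclSp n ≃ₗᵢ[ℝ] EuclSp n).toLinearEquiv : EuclSp n →ₗ[ℝ] EuclSp n)

theorem pointSum_apply [Fintype (pointGroup Γ)] (x : EuclSp n) :
    pointSum Γ x = ∑ A : pointGroup Γ, (A : EuclSp n ≃ₗᵢ[ℝ] EuclSp n) x := by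
  rw [pointSum, finsum_eq_sum_of_fintype, LinearMap.sum_apply]
  rfl

theorem euclTranslation_linPart_mem {γ : EuclIsom n} (hγ : γ ∈ Γ) {a : EuclSp n}
    (ha : euclTranslation a ∈ Γ) : euclTranslation (linPart γ a) ∈ Γ := by
  rw [← conj_euclTranslation]
  exact Γ.mul_mem (Γ.mul_mem hγ ha) (Γ.inv_mem hγ)

variable [DiscreteTopology Γ] [CompactSpace (OrbitSp Γ)]

theorem linPart_pointSum {γ : EuclIsom n} (hγ : γ ∈ Γ) (x : EuclSp n) :
    linPart γ (pointSum Γ x) = pointSum Γ x := by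
  have := finite_pointGroup Γ
  cases nonempty_fintype (pointGroup Γ)
  rw [pointSum_apply, map_sum]
  exact Fintype.sum_equiv (Equiv.mulLeft ⟨linPart γ, linPart_mem_pointGroup Γ hγ⟩) _ _
    fun A => rfl

theorem pointSum_linPart {γ : EuclIsom n} (hγ : γ ∈ Γ) (x : EuclSp n) :
    pointSum Γ (linPart γ x) = pointSum Γ x := by
  have := finite_pointGroup Γ
  cases nonempty_fintype (pointGroup Γ)
  rw [pointSum_apply, pointSum_apply]
  exact Fintype.sum_equiv (Equiv.mulRight ⟨linPart γ, linPart_mem_pointGroup Γ hγ⟩) _ _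
    fun A => rfl

theorem pointSum_of_fixed {x : EuclSp n} (hx : ∀ γ ∈ Γ, linPart γ x = x) :
    pointSum Γ x = (Nat.card (pointGroup Γ) : ℝ) • x := by
  have := finite_pointGroup Γ
  cases nonempty_fintype (pointGroup Γ)
  rw [pointSum_apply, Nat.card_eq_fintype_card, ← Finset.card_univ, Nat.cast_smul_eq_nsmul,
    ← Finset.sum_const]
  refine Finset.sum_congr rfl fun A _ => ?_
  obtain ⟨γ, hγ, h⟩ := A.2
  rw [← h]
  exact hx γ hγ

theorem euclTranslation_sum_mem {ι : Type*} (s : Finset ι) (f : ι → EuclSp n)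
    (H : Subgroup (EuclIsom n)) (h : ∀ i ∈ s, euclTranslation (f i) ∈ H) :
    euclTranslation (∑ i ∈ s, f i) ∈ H := by
  classical
  induction s using Finset.induction_on with
  | empty =>
    have : euclTranslation (0 : EuclSp n) = 1 := by ext1 x; exact zero_add x
    rw [Finset.sum_empty, this]; exact H.one_mem
  | insert a s ha ih =>
    rw [Finset.sum_insert ha, ← euclTranslation_mul]
    exact H.mul_mem (h a (Finset.mem_insert_self a s))
      (ih fun i hi => h i (Finset.mem_insert_of_mem hi))

theorem pointSum_mem_centerIn {a : EuclSp n} (ha : euclTranslation a ∈ Γ) :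
    euclTranslation (pointSum Γ a) ∈ centerIn Γ := by
  refine (euclTranslation_mem_centerIn Γ).2 ⟨?_, fun γ hγ => linPart_pointSum Γ hγ a⟩
  have := finite_pointGroup Γ
  cases nonempty_fintype (pointGroup Γ)
  rw [pointSum_apply]
  refine euclTranslation_sum_mem _ _ _ fun A _ => ?_
  obtain ⟨γ, hγ, h⟩ := A.2
  rw [← h]
  exact euclTranslation_linPart_mem Γ hγ ha

theorem pointSum_mem_centerSpan (x : EuclSp n) : pointSum Γ x ∈ centerSpan Γ := by
  have hx : x ∈ translationSpan Γ := translationSpan_eq_top Γ ▸ Submodule.mem_top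
  induction hx using Submodule.span_induction with
  | mem x hx => exact Submodule.subset_span (pointSum_mem_centerIn Γ hx)
  | zero => rw [map_zero]; exact zero_mem _
  | add x y _ _ hx hy => rw [map_add]; exact add_mem hx hy
  | smul c x _ hx => rw [map_smul]; exact Submodule.smul_mem _ c hx

/-- On a fixed vector `pointSum` is multiplication by the order of the point group, and its values
always lie in V. -/
theorem mem_centerSpan_iff {x : EuclSp n} :
    x ∈ centerSpan Γ ↔ ∀ γ ∈ Γ, linPart γ x = x := by
  refine ⟨fun hx γ hγ => linPart_of_mem_centerSpan Γ hx hγ, fun hx => ?_⟩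
  have := finite_pointGroup Γ
  have h := pointSum_mem_centerSpan Γ x
  rw [pointSum_of_fixed Γ hx] at h
  rwa [Submodule.smul_mem_iff _ (by exact_mod_cast Nat.card_pos.ne')] at h

end Center

/-! ### Tori -/

section Torus

/-- Exponentiated coordinates in a ℤ-basis of L give a continuous bijective homomorphism; V/L is
compact, being covered by a fundamental domain, so the inverse is continuous. -/
theorem isTorus_quotient {V : Type*} [NormedAddCommGroup V] [NormedSpace ℝ V]
    [FiniteDimensional ℝ V] (L : AddSubgroup V) [DiscreteTopology L.toIntSubmodule]
    [IsZLattice ℝ L.toIntSubmodule] :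
    IsTorus (Multiplicative (V ⧸ L)) (Module.finrank ℝ V) := by
  have : ProperSpace V := FiniteDimensional.proper ℝ V
  have := ZLattice.module_free ℝ L.toIntSubmodule
  have := ZLattice.module_finite ℝ L.toIntSubmodule
  let b := (Module.finBasisOfFinrankEq ℤ L.toIntSubmodule
    (ZLattice.rank ℝ L.toIntSubmodule)).ofZLatticeBasis ℝ L.toIntSubmodule
  have hb : Submodule.span ℤ (Set.range b) = L.toIntSubmodule :=
    Module.Basis.ofZLatticeBasis_span ℝ _ _
  have hL : ∀ v, v ∈ L ↔ v ∈ Submodule.span ℤ (Set.range b) := fun v => by rw [hb]; rfl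
  let F : V →+ Additive (Fin (Module.finrank ℝ V) → Circle) :=
    { toFun := fun v => Additive.ofMul fun i => Circle.exp (2 * Real.pi * b.repr v i)
      map_zero' := by
        apply Additive.toMul.injective
        ext1 i
        simp
      map_add' := fun v w => by
        apply Additive.toMul.injective
        ext1 i
        simp [mul_add, Circle.exp_add] }
  have hFc : Continuous fun v => (F v).toMul := by
    refine continuous_pi fun i => Circle.exp.continuous.comp (continuous_const.mul ?_)
    exact (LinearMap.continuous_of_finiteDimensional (b.coord i))
  have hker : ∀ v, F v = 0 ↔ v ∈ L := fun v => by
    rw [hL, b.mem_span_iff_repr_mem ℤ]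
    have : F v = 0 ↔ ∀ i, Circle.exp (2 * Real.pi * b.repr v i) = 1 :=
      ⟨fun h i => congrFun h i, fun h => funext h⟩
    rw [this]
    refine forall_congr' fun i => ?_
    rw [Circle.exp_eq_one]
    refine exists_congr fun k => ?_
    have hpi : 2 * Real.pi ≠ 0 := by positivity
    rw [mul_comm (k : ℝ), mul_right_inj' hpi, eq_comm]
    rfl
  let G : (V ⧸ L) →+ Additive (Fin (Module.finrank ℝ V) → Circle) :=
    QuotientAddGroup.lift L F fun v hv => (hker v).2 hv
  have hGinj : Function.Injective G := by
    rw [injective_iff_map_eq_zero]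
    rintro ⟨v⟩ hv
    exact (QuotientAddGroup.eq_zero_iff v).2 ((hker v).1 hv)
  have hGsurj : Function.Surjective G := by
    intro z
    choose t ht using fun i => Circle.exp_surjective (z.toMul i)
    refine ⟨QuotientAddGroup.mk (∑ i, (t i / (2 * Real.pi)) • b i), ?_⟩
    refine funext fun i => ?_
    change Circle.exp (2 * Real.pi * b.repr (∑ i, (t i / (2 * Real.pi)) • b i) i) = _
    rw [b.repr_sum_self, mul_div_cancel₀ _ (by positivity : 2 * Real.pi ≠ 0)]
    exact ht i
  have hGc : Continuous fun q : V ⧸ L => (G q).toMul :=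
    (QuotientAddGroup.isQuotientMap_mk L).continuous_iff.2 hFc
  have hcpt : CompactSpace (V ⧸ L) := by
    have hK := (isCompact_closedBall (0 : V) (∑ i, ‖b i‖)).image
      (QuotientAddGroup.isQuotientMap_mk L).continuous
    refine ⟨hK.of_isClosed_subset isClosed_univ ?_⟩
    rintro ⟨v⟩ -
    refine ⟨ZSpan.fract b v, mem_closedBall_zero_iff.2 (ZSpan.norm_fract_le b v), ?_⟩
    refine QuotientAddGroup.eq.2 ?_
    rw [ZSpan.fract_apply, neg_sub, sub_add_cancel, hL]
    exact (ZSpan.floor b v).2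
  have : CompactSpace (Multiplicative (V ⧸ L)) := hcpt
  let e : Multiplicative (V ⧸ L) ≃* (Fin (Module.finrank ℝ V) → Circle) :=
    MulEquiv.ofBijective (AddMonoidHom.toMultiplicativeLeft G) ⟨hGinj, hGsurj⟩
  have hec : Continuous e.toEquiv := hGc
  exact ⟨{ e with
    continuous_toFun := hec
    continuous_invFun := hec.continuous_symm_of_equiv_compact_to_t2 }⟩

end Torus

/-! ### The first Betti number -/

section Betti

variable {n : ℕ} (Γ : Subgroup (EuclIsom n))

theorem mem_centerLattice {v : centerSpan Γ} :
    v ∈ centerLattice Γ ↔ euclTranslation (v : EuclSp n) ∈ centerIn Γ := Iff.rfl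

theorem discreteTopology_centerLattice [DiscreteTopology Γ] :
    DiscreteTopology (centerLattice Γ).toIntSubmodule := by
  refine discreteTopology_of_isOpen_singleton_zero (Metric.isOpen_singleton_iff.2 ?_)
  obtain ⟨ε, hε, h⟩ := exists_isolated Γ
  refine ⟨ε, hε, fun v hv => ?_⟩
  rw [dist_zero_right] at hv
  have hmem : euclTranslation (v : EuclSp n) ∈ Γ := ((mem_centerIn Γ).1 v.2).1
  have h1 := h _ hmem
    (by rwa [(linPart_eq_one_iff _).1 (linPart_euclTranslation _), norm_zero])
    (by rwa [euclTranslation_apply, add_zero])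
  have h2 := congrArg (fun g : EuclIsom n => g 0) h1
  have h3 : ((v : centerSpan Γ) : EuclSp n) = 0 := by
    rw [← add_zero ((v : centerSpan Γ) : EuclSp n)]; exact h2
  exact Subtype.ext (Subtype.ext h3)

theorem isZLattice_centerLattice [DiscreteTopology (centerLattice Γ).toIntSubmodule] :
    IsZLattice ℝ (centerLattice Γ).toIntSubmodule :=
  ⟨Submodule.span_span_coe_preimage⟩

/-- The vectors `a` such that the translation by `a` belongs to `Γ`. -/
def translationLattice : AddSubgroup (EuclSp n) where
  carrier := {a | euclTranslation a ∈ Γ}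
  zero_mem' := by
    have h : euclTranslation (0 : EuclSp n) = 1 := by ext1 x; exact zero_add x
    change euclTranslation (0 : EuclSp n) ∈ Γ
    rw [h]
    exact one_mem _
  add_mem' := by
    intro a b ha hb
    change euclTranslation (a + b) ∈ Γ
    rw [← euclTranslation_mul]
    exact mul_mem ha hb
  neg_mem' := by
    intro a ha
    have h : euclTranslation (-a) = (euclTranslation a)⁻¹ := by ext1 x; rfl
    change euclTranslation (-a) ∈ Γ
    rw [h]
    exact inv_mem ha

/-- The class of a translation in the abelianization of `Γ`. -/
noncomputable def translationClass : translationLattice Γ →+ Additive (Abelianization Γ) where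
  toFun a := Additive.ofMul (Abelianization.of ⟨euclTranslation (a : EuclSp n), a.2⟩)
  map_zero' := by
    have h : (⟨euclTranslation ((0 : translationLattice Γ) : EuclSp n),
      (0 : translationLattice Γ).2⟩ : Γ) = 1 := Subtype.ext (by ext1 x; exact zero_add x)
    rw [h, map_one]; rfl
  map_add' a b := by
    rw [← ofMul_mul, ← map_mul]
    congr 2
    exact Subtype.ext (euclTranslation_mul (a : EuclSp n) b).symm

/-- The two translations are conjugate in Γ. -/
theorem translationClass_linPart {γ : EuclIsom n} (hγ : γ ∈ Γ) (a : translationLattice Γ) :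
    translationClass Γ ⟨linPart γ a, euclTranslation_linPart_mem Γ hγ a.2⟩ =
      translationClass Γ a := by
  have h : (⟨euclTranslation (linPart γ a), euclTranslation_linPart_mem Γ hγ a.2⟩ : Γ) =
      ⟨γ, hγ⟩ * ⟨euclTranslation (a : EuclSp n), a.2⟩ * ⟨γ, hγ⟩⁻¹ :=
    Subtype.ext (conj_euclTranslation γ a).symm
  refine congrArg Additive.ofMul ?_
  rw [h, map_mul, map_mul, map_inv, mul_inv_cancel_comm]

variable [DiscreteTopology Γ] [CompactSpace (OrbitSp Γ)]

theorem pointSum_mem_translationLattice (a : translationLattice Γ) :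
    pointSum Γ a ∈ translationLattice Γ :=
  ((mem_centerIn Γ).1 (pointSum_mem_centerIn Γ a.2)).1

theorem translationClass_pointSum (a : translationLattice Γ) :
    translationClass Γ ⟨pointSum Γ a, pointSum_mem_translationLattice Γ a⟩ =
      Nat.card (pointGroup Γ) • translationClass Γ a := by
  have := finite_pointGroup Γ
  cases nonempty_fintype (pointGroup Γ)
  have hmem : ∀ A : pointGroup Γ,
      (A : EuclSp n ≃ₗᵢ[ℝ] EuclSp n) (a : EuclSp n) ∈ translationLattice Γ := by
    rintro ⟨A, γ, hγ, rfl⟩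
    exact euclTranslation_linPart_mem Γ hγ a.2
  have h : (⟨pointSum Γ a, pointSum_mem_translationLattice Γ a⟩ : translationLattice Γ) =
      ∑ A : pointGroup Γ, ⟨(A : EuclSp n ≃ₗᵢ[ℝ] EuclSp n) a, hmem A⟩ := by
    apply Subtype.ext
    rw [AddSubgroup.val_finsetSum]
    exact pointSum_apply Γ _
  rw [h, map_sum, Nat.card_eq_fintype_card, ← Finset.card_univ, ← Finset.sum_const]
  refine Finset.sum_congr rfl ?_
  rintro ⟨A, γ, hγ, rfl⟩ -
  exact translationClass_linPart Γ hγ a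

theorem linPart_pow_card {γ : EuclIsom n} (hγ : γ ∈ Γ) :
    linPart (γ ^ Nat.card (pointGroup Γ)) = 1 := by
  have := finite_pointGroup Γ
  have h := pow_card_eq_one' (x := (⟨linPart γ, linPart_mem_pointGroup Γ hγ⟩ : pointGroup Γ))
  exact (map_pow (linHom n) γ _).trans (congrArg Subtype.val h)

theorem pow_card_mem_translationLattice {γ : EuclIsom n} (hγ : γ ∈ Γ) :
    (γ ^ Nat.card (pointGroup Γ)) 0 ∈ translationLattice Γ := by
  change euclTranslation _ ∈ Γ
  rw [← eq_euclTranslation (linPart_pow_card Γ hγ)]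
  exact pow_mem hγ _

/-- The cocycle γ ↦ `γ 0` becomes additive because `pointSum` absorbs linear parts. -/
theorem pointSum_mul_apply_zero {γ : EuclIsom n} (hγ : γ ∈ Γ) (δ : EuclIsom n) :
    pointSum Γ ((γ * δ) 0) = pointSum Γ (γ 0) + pointSum Γ (δ 0) := by
  rw [isom_mul_apply, isom_apply, map_add, pointSum_linPart Γ hγ, add_comm]

theorem pointSum_pow_apply_zero {γ : EuclIsom n} (hγ : γ ∈ Γ) (k : ℕ) :
    pointSum Γ ((γ ^ k) 0) = k • pointSum Γ (γ 0) := by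
  induction k with
  | zero => rw [zero_smul, pow_zero]; exact map_zero _
  | succ k ih => rw [pow_succ, pointSum_mul_apply_zero Γ (pow_mem hγ k), ih, succ_nsmul]

/-- With N the order of the point group, γ ^ N is a translation, so the factor N brings the vector
into the lattice. -/
theorem card_smul_pointSum_mem {γ : EuclIsom n} (hγ : γ ∈ Γ) :
    euclTranslation (Nat.card (pointGroup Γ) • pointSum Γ (γ 0)) ∈ centerIn Γ := by
  rw [← pointSum_pow_apply_zero Γ hγ]
  exact pointSum_mem_centerIn Γ (pow_card_mem_translationLattice Γ hγ)

/-- A homomorphism from `Γ` to the lattice of central translations. -/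
noncomputable def centralTransfer : Γ →* Multiplicative (centerLattice Γ) where
  toFun γ := Multiplicative.ofAdd
    ⟨⟨Nat.card (pointGroup Γ) • pointSum Γ ((γ : EuclIsom n) 0),
      Submodule.subset_span (card_smul_pointSum_mem Γ γ.2)⟩, card_smul_pointSum_mem Γ γ.2⟩
  map_one' := by
    apply Multiplicative.toAdd.injective
    refine Subtype.ext (Subtype.ext ?_)
    change Nat.card (pointGroup Γ) • pointSum Γ 0 = 0
    rw [map_zero, smul_zero]
  map_mul' γ δ := by
    apply Multiplicative.toAdd.injective
    refine Subtype.ext (Subtype.ext ?_)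
    change Nat.card (pointGroup Γ) • pointSum Γ (((γ : EuclIsom n) * (δ : EuclIsom n)) 0) =
      Nat.card (pointGroup Γ) • pointSum Γ ((γ : EuclIsom n) 0) +
      Nat.card (pointGroup Γ) • pointSum Γ ((δ : EuclIsom n) 0)
    rw [pointSum_mul_apply_zero Γ γ.2, smul_add]

/-- The homomorphism from `H₁(Γ)` to the lattice of central translations. -/
noncomputable def homologyTransfer : Additive (Abelianization Γ) →+ centerLattice Γ :=
  MonoidHom.toAdditiveLeft (Abelianization.lift (centralTransfer Γ))

theorem coe_homologyTransfer_of (γ : Γ) :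
    ((homologyTransfer Γ (Additive.ofMul (Abelianization.of γ)) : centerSpan Γ) : EuclSp n) =
      Nat.card (pointGroup Γ) • pointSum Γ ((γ : EuclIsom n) 0) := rfl

/-- A central translation is a translation in `Γ`. -/
def centerLatticeInclusion : centerLattice Γ →+ translationLattice Γ where
  toFun v := ⟨(v : centerSpan Γ), ((mem_centerIn Γ).1 v.2).1⟩
  map_zero' := rfl
  map_add' _ _ := rfl

theorem coe_homologyTransfer_translationClass (a : translationLattice Γ) :
    ((homologyTransfer Γ (translationClass Γ a) : centerSpan Γ) : EuclSp n) =
      Nat.card (pointGroup Γ) • pointSum Γ (a : EuclSp n) := by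
  have h := coe_homologyTransfer_of Γ ⟨euclTranslation (a : EuclSp n), a.2⟩
  refine h.trans ?_
  rw [euclTranslation_apply, add_zero]

/-- Followed by the transfer, this map is multiplication by N² on a torsion-free group. -/
theorem translationClass_centerLattice_injective :
    Function.Injective ((translationClass Γ).comp (centerLatticeInclusion Γ)) := by
  have := finite_pointGroup Γ
  have hN : Nat.card (pointGroup Γ) ≠ 0 := Nat.card_pos.ne'
  rw [injective_iff_map_eq_zero]
  intro v hv
  have h1 := coe_homologyTransfer_translationClass Γ (centerLatticeInclusion Γ v)
  rw [show translationClass Γ (centerLatticeInclusion Γ v) = 0 from hv, map_zero] at h1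
  have h2 : Nat.card (pointGroup Γ) • pointSum Γ ((v : centerSpan Γ) : EuclSp n) = 0 := h1.symm
  rw [← Nat.cast_smul_eq_nsmul ℝ, smul_eq_zero_iff_right (by exact_mod_cast hN), pointSum_of_fixed Γ
    fun γ hγ => linPart_of_mem_centerSpan Γ (v : centerSpan Γ).2 hγ,
    smul_eq_zero_iff_right (by exact_mod_cast hN)] at h2
  exact Subtype.ext (Subtype.ext h2)

/-- The translation γ ^ N has vector a with `pointSum Γ a` = 0. The class of `pointSum Γ a` is N
times that of a, hence N² times that of γ. -/
theorem smul_eq_zero_of_homologyTransfer_eq_zero {x : Additive (Abelianization Γ)}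
    (hx : homologyTransfer Γ x = 0) :
    (Nat.card (pointGroup Γ) * Nat.card (pointGroup Γ)) • x = 0 := by
  obtain ⟨γ, rfl⟩ : ∃ γ : Γ, Additive.ofMul (Abelianization.of γ) = x := by
    obtain ⟨γ, h⟩ := QuotientGroup.mk_surjective x.toMul
    exact ⟨γ, h⟩
  have h1 : Nat.card (pointGroup Γ) • pointSum Γ ((γ : EuclIsom n) 0) = 0 := by
    rw [← coe_homologyTransfer_of, hx]; rfl
  rw [← pointSum_pow_apply_zero Γ γ.2] at h1
  have h2 := translationClass_pointSum Γ ⟨_, pow_card_mem_translationLattice Γ γ.2⟩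
  have h3 : (⟨_, pointSum_mem_translationLattice Γ
      ⟨_, pow_card_mem_translationLattice Γ γ.2⟩⟩ : translationLattice Γ) = 0 :=
    Subtype.ext h1
  have h4 : translationClass Γ ⟨_, pow_card_mem_translationLattice Γ γ.2⟩ =
      Nat.card (pointGroup Γ) • Additive.ofMul (Abelianization.of γ) := by
    rw [← ofMul_pow, ← map_pow]
    refine congrArg Additive.ofMul (congrArg Abelianization.of (Subtype.ext ?_))
    exact (eq_euclTranslation (linPart_pow_card Γ γ.2)).symm
  rw [h3, map_zero, h4, smul_smul] at h2
  exact h2.symm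

/-- Maps in both directions between H₁(Γ) and Z(Γ), one injective and one with torsion kernel,
equate the ranks; Z(Γ) is a lattice in V. -/
theorem firstBetti_eq_finrank : firstBetti Γ = Module.finrank ℝ (centerSpan Γ) := by
  have := discreteTopology_centerLattice Γ
  have := isZLattice_centerLattice Γ
  have := finite_pointGroup Γ
  have hN : Nat.card (pointGroup Γ) ≠ 0 := Nat.card_pos.ne'
  have hker : Module.rank ℤ (homologyTransfer Γ).toIntLinearMap.ker = 0 := by
    rw [rank_eq_zero_iff]
    rintro ⟨x, hx⟩
    refine ⟨(Nat.card (pointGroup Γ) * Nat.card (pointGroup Γ) : ℕ),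
      by exact_mod_cast mul_ne_zero hN hN, Subtype.ext ?_⟩
    rw [natCast_zsmul]
    exact smul_eq_zero_of_homologyTransfer_eq_zero Γ hx
  have hrank : Module.rank ℤ (Additive (Abelianization Γ)) = Module.rank ℤ (centerLattice Γ) := by
    refine le_antisymm ?_ (LinearMap.rank_le_of_injective
      ((translationClass Γ).comp (centerLatticeInclusion Γ)).toIntLinearMap
      (translationClass_centerLattice_injective Γ))
    rw [← LinearMap.rank_range_add_rank_ker (homologyTransfer Γ).toIntLinearMap, hker, add_zero]
    exact Submodule.rank_le _
  have h5 : Module.finrank ℤ (centerLattice Γ) = Module.finrank ℝ (centerSpan Γ) :=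
    ZLattice.rank ℝ (centerLattice Γ).toIntSubmodule
  rw [← h5]
  exact congrArg Cardinal.toNat hrank

theorem isTorus_centerTorus : IsTorus (CenterTorus Γ) (firstBetti Γ) := by
  have := discreteTopology_centerLattice Γ
  have := isZLattice_centerLattice Γ
  rw [firstBetti_eq_finrank]
  exact isTorus_quotient (centerLattice Γ)

end Betti

/-! ### The isometry group of a compact space -/

section CompactIsom

open Filter Topology

variable {X : Type*} [PseudoMetricSpace X]

theorem t2Space_isometryEquiv [T2Space X] : T2Space (X ≃ᵢ X) :=
  T2Space.of_injective_continuous (f := fun f : X ≃ᵢ X => (⟨f, f.continuous⟩ : C(X, X)))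
    (fun _ _ h => IsometryEquiv.ext fun x => congrArg (fun F : C(X, X) => F x) h)
    continuous_induced_dom

variable [CompactSpace X]

theorem isometryEquiv_nhds_basis (f : X ≃ᵢ X) :
    (𝓝 f).HasBasis (fun ε : ℝ => 0 < ε) (fun ε => {g : X ≃ᵢ X | ∀ x, dist (g x) (f x) < ε}) := by
  rw [nhds_induced]
  refine (Metric.nhds_basis_ball.comap _).congr (fun _ => Iff.rfl) fun ε hε => ?_
  ext g
  exact ContinuousMap.dist_lt_iff hε

theorem isTopologicalGroup_isometryEquiv : IsTopologicalGroup (X ≃ᵢ X) where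
  continuous_mul := by
    refine continuous_iff_continuousAt.2 fun ⟨f, g⟩ => ?_
    refine ((isometryEquiv_nhds_basis f).prod_nhds (isometryEquiv_nhds_basis g)).tendsto_iff
      (isometryEquiv_nhds_basis (f * g)) |>.2 fun ε hε => ?_
    refine ⟨(ε / 2, ε / 2), ⟨half_pos hε, half_pos hε⟩, ?_⟩
    rintro ⟨f', g'⟩ ⟨hf, hg⟩ x
    have h1 : dist (f' (g' x)) (f (g' x)) < ε / 2 := hf (g' x)
    have h2 : dist (f (g' x)) (f (g x)) < ε / 2 := (f.dist_eq _ _).trans_lt (hg x)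
    have h3 := dist_triangle (f' (g' x)) (f (g' x)) (f (g x))
    change dist (f' (g' x)) (f (g x)) < ε
    linarith
  continuous_inv := by
    refine continuous_iff_continuousAt.2 fun f => ?_
    refine (isometryEquiv_nhds_basis f).tendsto_iff (isometryEquiv_nhds_basis f⁻¹) |>.2
      fun ε hε => ⟨ε, hε, fun g hg x => ?_⟩
    change dist (g.symm x) (f.symm x) < ε
    rw [← g.dist_eq, g.apply_symm_apply, dist_comm]
    have := hg (f.symm x)
    rwa [f.apply_symm_apply] at this

/-- An isometric self-map of a compact space is surjective. -/
theorem Isometry.surjective_of_compact [T2Space X] {f : X → X} (hf : Isometry f) :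
    Function.Surjective f := by
  by_contra hns
  obtain ⟨y, hy⟩ : ∃ y, y ∉ Set.range f := by
    rw [Function.Surjective] at hns
    push Not at hns
    obtain ⟨y, hy⟩ := hns
    exact ⟨y, fun ⟨x, hx⟩ => hy x hx⟩
  have hcl : IsClosed (Set.range f) := (isCompact_range hf.continuous).isClosed
  obtain ⟨ε, hε, hball⟩ := Metric.isOpen_iff.1 hcl.isOpen_compl y hy
  -- The iterates of y are ε-separated: stripping off the common isometry compares y with a point of
  -- the range. This contradicts compactness.
  obtain ⟨φ, hφ, h⟩ := exists_close_subseq (isCompact_univ (X := X)).isBounded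
    (x := fun k => f^[k] y) (fun _ => Set.mem_univ _) hε
  have h01 := hφ zero_lt_one
  obtain ⟨d, hd⟩ := Nat.exists_eq_add_of_lt h01
  have h1 := h 1 0
  have hit : Isometry f^[φ 0] := by
    induction φ 0 with
    | zero => exact isometry_id
    | succ k ih => rw [Function.iterate_succ]; exact ih.comp hf
  rw [hd, add_assoc, Function.iterate_add_apply, hit.dist_eq, Function.iterate_succ_apply'] at h1
  exact hball (Metric.mem_ball.2 h1) ⟨_, rfl⟩

/-- Since isometric self-maps are automatically surjective, the image in C(X, X) is cut out by
closed pointwise conditions, and Arzelà–Ascoli applies. -/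
theorem compactSpace_isometryEquiv [T2Space X] : CompactSpace (X ≃ᵢ X) := by
  have hind : IsInducing (fun f : X ≃ᵢ X => (⟨f, f.continuous⟩ : C(X, X))) := ⟨rfl⟩
  refine ⟨hind.isCompact_iff.2 ?_⟩
  have hrange : (fun f : X ≃ᵢ X => (⟨f, f.continuous⟩ : C(X, X))) '' Set.univ =
      {f : C(X, X) | Isometry f} := by
    ext f
    constructor
    · rintro ⟨g, -, rfl⟩; exact g.isometry
    · intro hf
      have hinj : Function.Injective f := by
        intro x y hxy
        have : dist x y = 0 := by rw [← hf.dist_eq, hxy, dist_self]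
        exact (Metric.inseparable_iff.2 this).eq
      exact ⟨⟨Equiv.ofBijective f ⟨hinj, Isometry.surjective_of_compact hf⟩, hf⟩, trivial,
        ContinuousMap.ext fun _ => rfl⟩
  rw [hrange]
  refine ArzelaAscoli.isCompact_of_equicontinuous _ ?_ ?_
  · have : ContinuousMap.toFun '' {f : C(X, X) | Isometry f} =
        ⋂ (x : X) (y : X), {f : X → X | dist (f x) (f y) = dist x y} := by
      ext f
      simp only [Set.mem_image, Set.mem_iInter, Set.mem_ofPred_eq]
      constructor
      · rintro ⟨g, hg, rfl⟩ x y; exact hg.dist_eq x y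
      · intro h
        have hf : Isometry f := Isometry.of_dist_eq h
        exact ⟨⟨f, hf.continuous⟩, hf, rfl⟩
    rw [this]
    refine IsClosed.isCompact (isClosed_iInter fun x => isClosed_iInter fun y => ?_)
    exact isClosed_eq (by fun_prop) continuous_const
  · intro x
    rw [Metric.equicontinuousAt_iff]
    intro ε hε
    exact ⟨ε, hε, fun y hy f => by
      rw [f.2.dist_eq, dist_comm]; exact hy⟩

end CompactIsom

/-! ### Extension of isometric maps of balls -/

section Extension

open scoped InnerProductSpace

/-- An isometric map of a ball into a Euclidean space is the restriction of an affine isometry. -/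
theorem exists_linearIsometryEquiv_of_isometric_ball {V : Type*} [NormedAddCommGroup V]
    [InnerProductSpace ℝ V] [FiniteDimensional ℝ V] {x₀ : V} {r : ℝ} (hr : 0 < r) {f : V → V}
    (hf : ∀ x ∈ Metric.ball x₀ r, ∀ y ∈ Metric.ball x₀ r, dist (f x) (f y) = dist x y) :
    ∃ A : V ≃ₗᵢ[ℝ] V, ∀ x ∈ Metric.ball x₀ r, f x = f x₀ + A (x - x₀) := by
  have hx₀ : x₀ ∈ Metric.ball x₀ r := Metric.mem_ball_self hr
  have hinner : ∀ x ∈ Metric.ball x₀ r, ∀ y ∈ Metric.ball x₀ r,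
      ⟪f x - f x₀, f y - f x₀⟫_ℝ = ⟪x - x₀, y - x₀⟫_ℝ := by
    intro x hx y hy
    rw [real_inner_eq_norm_mul_self_add_norm_mul_self_sub_norm_sub_mul_self_div_two,
      real_inner_eq_norm_mul_self_add_norm_mul_self_sub_norm_sub_mul_self_div_two,
      sub_sub_sub_cancel_right, sub_sub_sub_cancel_right]
    simp only [← dist_eq_norm, hf x hx x₀ hx₀, hf y hy x₀ hx₀, hf x hx y hy]
  let b := stdOrthonormalBasis ℝ V
  have hs : 0 < r / 2 := half_pos hr
  have hmem : ∀ i, x₀ + (r / 2) • b i ∈ Metric.ball x₀ r := fun i => by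
    rw [mem_ball_iff_norm, add_sub_cancel_left, norm_smul, b.norm_eq_one, mul_one,
      Real.norm_eq_abs, abs_of_pos hs]
    linarith
  -- f preserves inner products based at x₀, so these rescaled images of the basis are orthonormal,
  -- and f has the same coordinates in them as the identity has in b.
  let c : Fin (Module.finrank ℝ V) → V := fun i => (r / 2)⁻¹ • (f (x₀ + (r / 2) • b i) - f x₀)
  have hc : ∀ i, ∀ x ∈ Metric.ball x₀ r, ⟪c i, f x - f x₀⟫_ℝ = ⟪b i, x - x₀⟫_ℝ := by
    intro i x hx
    rw [real_inner_smul_left, hinner _ (hmem i) x hx, add_sub_cancel_left, real_inner_smul_left,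
      inv_mul_cancel_left₀ hs.ne']
  have hcon : Orthonormal ℝ c := by
    rw [orthonormal_iff_ite]
    intro i j
    change ⟪c i, (r / 2)⁻¹ • _⟫_ℝ = _
    rw [real_inner_smul_right, hc i _ (hmem j), add_sub_cancel_left, real_inner_smul_right,
      inv_mul_cancel_left₀ hs.ne']
    exact orthonormal_iff_ite.1 b.orthonormal i j
  have hspan : ⊤ ≤ Submodule.span ℝ (Set.range c) := by
    have h := hcon.linearIndependent.span_eq_top_of_card_eq_finrank' (Fintype.card_fin _)
    exact h.ge
  let c' : OrthonormalBasis (Fin (Module.finrank ℝ V)) ℝ V := OrthonormalBasis.mk hcon hspan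
  have hc' : ∀ i, c' i = c i := fun i => by simp [c']
  refine ⟨b.equiv c' (Equiv.refl _), fun x hx => ?_⟩
  rw [← sub_eq_iff_eq_add']
  refine c'.repr.injective ?_
  ext i
  rw [c'.repr_apply_apply, c'.repr_apply_apply, hc', hc i x hx,
    ← (b.equiv c' (Equiv.refl _)).inner_map_map (b i) (x - x₀)]
  simp [hc']

end Extension

/-! ### Lifting isometries of the orbit space that are close to the identity -/

section Lifting

open scoped InnerProductSpace

variable {n : ℕ}

/-- The affine subspace on which two isometries agree. -/
noncomputable def agreeSubspace (g h : EuclIsom n) : AffineSubspace ℝ (EuclSp n) where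
  carrier := {x | g x = h x}
  smul_vsub_vadd_mem' c p q x hp hq hx := by
    have e : ∀ k : EuclIsom n, k (c • (p - q) + x) = c • (k p - k q) + k x := fun k => by
      rw [isom_apply k (c • (p - q) + x), map_add, map_smul, ← isom_sub, add_assoc, ← isom_apply]
    change g (c • (p - q) + x) = h (c • (p - q) + x)
    rw [e, e, show g p = h p from hp, show g q = h q from hq, show g x = h x from hx]

theorem agreeSubspace_ne_top {g h : EuclIsom n} (hne : g ≠ h) : agreeSubspace g h ≠ ⊤ := by
  intro htop
  refine hne (IsometryEquiv.ext fun x => ?_)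
  have : x ∈ agreeSubspace g h := htop ▸ AffineSubspace.mem_top ℝ _ x
  exact this

/-- Countably many pairs of distinct isometries are told apart by a point of any open set. -/
theorem exists_forall_apply_ne {S : Set (EuclIsom n × EuclIsom n)} (hS : S.Countable)
    (hne : ∀ p ∈ S, p.1 ≠ p.2) {U : Set (EuclSp n)} (hU : IsOpen U) (hU0 : U.Nonempty) :
    ∃ x ∈ U, ∀ p ∈ S, p.1 x ≠ p.2 x := by
  by_contra! hcon
  have h0 : MeasureTheory.volume (⋃ p ∈ S, (agreeSubspace p.1 p.2 : Set (EuclSp n))) = 0 := by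
    rw [MeasureTheory.measure_biUnion_null_iff hS]
    exact fun p hp => MeasureTheory.Measure.addHaar_affineSubspace _ _
      (agreeSubspace_ne_top (hne p hp))
  have hsub : U ⊆ ⋃ p ∈ S, (agreeSubspace p.1 p.2 : Set (EuclSp n)) := fun x hx => by
    obtain ⟨p, hp, h⟩ := hcon x hx
    exact Set.mem_biUnion hp h
  exact (hU.measure_pos MeasureTheory.volume hU0).ne'
    (MeasureTheory.measure_mono_null hsub h0)

theorem exists_regular_point (Γ : Subgroup (EuclIsom n)) [DiscreteTopology Γ] :
    ∃ x : EuclSp n, ∀ γ ∈ Γ, γ x = x → γ = 1 := by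
  obtain ⟨x, -, hx⟩ := exists_forall_apply_ne
    (S := (fun γ : EuclIsom n => (γ, (1 : EuclIsom n))) '' {γ | γ ∈ Γ ∧ γ ≠ 1})
    (((countable_of_discrete Γ).mono fun γ h => h.1).image _)
    (by rintro _ ⟨γ, h, rfl⟩; exact h.2) isOpen_univ Set.univ_nonempty
  refine ⟨x, fun γ hγ h => ?_⟩
  by_contra hne
  exact hx _ ⟨γ, ⟨hγ, hne⟩, rfl⟩ h

/-- Orbits are locally finite, so only finitely many elements give a distance between R and R + 1.
-/
theorem exists_gap (Γ : Subgroup (EuclIsom n)) [DiscreteTopology Γ] (y u : EuclSp n) (R : ℝ) :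
    ∃ ρ > 0, ∀ γ ∈ Γ, R < dist y (γ u) → R + ρ ≤ dist y (γ u) := by
  obtain ⟨ρ, hρ, h⟩ : ∃ ρ > 0, ∀ γ ∈ {γ : EuclIsom n | (γ ∈ Γ ∧ dist y (γ u) ≤ R + 1) ∧
      R < dist y (γ u)}, R + ρ ≤ dist y (γ u) := by
    have hfin := (finite_dist_le Γ y u (R + 1)).inter_of_left {γ | R < dist y (γ u)}
    rcases Set.eq_empty_or_nonempty {γ : EuclIsom n | (γ ∈ Γ ∧ dist y (γ u) ≤ R + 1) ∧
      R < dist y (γ u)} with he | hne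
    · exact ⟨1, one_pos, fun γ hγ => by rw [he] at hγ; exact hγ.elim⟩
    · obtain ⟨γ, hγ, hmin⟩ := Set.exists_min_image _ (fun γ : EuclIsom n => dist y (γ u)) hfin hne
      exact ⟨dist y (γ u) - R, sub_pos.2 hγ.2, fun δ hδ => by linarith [hmin δ hδ]⟩
  refine ⟨min ρ 1, lt_min hρ one_pos, fun γ hγ hlt => ?_⟩
  by_cases hle : dist y (γ u) ≤ R + 1
  · linarith [h γ ⟨⟨hγ, hle⟩, hlt⟩, min_le_left ρ 1]
  · linarith [min_le_right ρ 1]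

theorem exists_regular_separation (Γ : Subgroup (EuclIsom n)) [DiscreteTopology Γ] :
    ∃ (x : EuclSp n) (r : ℝ), 0 < r ∧ ∀ γ ∈ Γ, γ ≠ 1 → 4 * r ≤ dist x (γ x) := by
  obtain ⟨x, hx⟩ := exists_regular_point Γ
  obtain ⟨ρ, hρ, h⟩ := exists_gap Γ x x 0
  refine ⟨x, ρ / 4, by positivity, fun γ hγ hne => ?_⟩
  have := h γ hγ (dist_pos.2 fun he => hne (hx γ hγ he.symm))
  linarith

/-- A nontrivial γ moves q to distance at least 2r from p, while p and q are less than 2r apart. -/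
theorem dist_orbitPt_eq_of_mem_ball {Γ : Subgroup (EuclIsom n)} {x₀ : EuclSp n} {r : ℝ}
    (hsep : ∀ γ ∈ Γ, γ ≠ 1 → 4 * r ≤ dist x₀ (γ x₀)) {p q : EuclSp n}
    (hp : p ∈ Metric.ball x₀ r) (hq : q ∈ Metric.ball x₀ r) :
    dist (orbitPt Γ p) (orbitPt Γ q) = dist p q := by
  refine le_antisymm (dist_orbitPt_le Γ p q) (le_dist_orbitPt Γ fun γ hγ => ?_)
  rcases eq_or_ne γ 1 with rfl | hne
  · exact le_rfl
  have h1 := hsep γ hγ hne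
  have h2 := dist_triangle4 x₀ p (γ q) (γ x₀)
  have h3 := dist_triangle p x₀ q
  rw [γ.dist_eq] at h2
  rw [Metric.mem_ball] at hp hq
  rw [dist_comm x₀ p] at h2
  rw [dist_comm x₀ q] at h3
  linarith

/-- If three points in a Euclidean space realise equality in the triangle inequality, the third
is determined by the first two. -/
theorem eq_of_dist_le_of_le_dist {u x w : EuclSp n} {t : ℝ} (ht0 : 0 < t) (ht1 : t ≤ 1)
    (h1 : dist (u + t • (x - u)) w ≤ (1 - t) * dist x u) (h2 : dist x u ≤ dist w u) : w = x := by
  rw [dist_comm, dist_eq_norm] at h1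
  rw [dist_eq_norm] at h1
  rw [dist_eq_norm, dist_eq_norm] at h2
  set d := x - u with hd
  set a := w - (u + t • d) with ha
  have hw : w - u = a + t • d := by rw [ha]; abel
  have hsq : ‖a‖ ^ 2 ≤ ((1 - t) * ‖d‖) ^ 2 := pow_le_pow_left₀ (norm_nonneg _) h1 2
  have h3 : ‖d‖ ^ 2 ≤ ‖a + t • d‖ ^ 2 := pow_le_pow_left₀ (norm_nonneg _) (hw ▸ h2) 2
  rw [norm_add_sq_real, real_inner_smul_right, norm_smul, Real.norm_eq_abs, mul_pow, sq_abs] at h3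
  have h4 : (1 - t) * ‖d‖ ^ 2 ≤ ⟪a, d⟫_ℝ := by
    have : 0 ≤ 2 * t * (⟪a, d⟫_ℝ - (1 - t) * ‖d‖ ^ 2) := by nlinarith
    have := nonneg_of_mul_nonneg_right this (by positivity)
    linarith
  have h5 : ‖a - (1 - t) • d‖ ^ 2 ≤ 0 := by
    rw [norm_sub_sq_real, real_inner_smul_right, norm_smul, Real.norm_eq_abs, mul_pow, sq_abs]
    nlinarith [mul_le_mul_of_nonneg_left h4 (sub_nonneg.2 ht1)]
  have h6 : a - (1 - t) • d = 0 := by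
    rw [← norm_eq_zero, ← sq_eq_zero_iff]; exact le_antisymm h5 (sq_nonneg _)
  have h7 : w - x = a - (1 - t) • d := by rw [ha, hd]; module
  exact sub_eq_zero.1 (h7.trans h6)

/-- By the parallelogram law, the ball with diameter uq contains only one point at distance 2R from
q. -/
theorem eq_of_midpoint {u q w : EuclSp n} {R : ℝ} (hR : dist q u = 2 * R)
    (h1 : dist w ((2⁻¹ : ℝ) • (u + q)) ≤ R) (h2 : 2 * R ≤ dist w q) : w = u := by
  rw [dist_eq_norm] at *
  set y := (2⁻¹ : ℝ) • (u + q) with hy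
  have hb : ‖q - y‖ = R := by
    have : q - y = (2⁻¹ : ℝ) • (q - u) := by rw [hy]; module
    rw [this, norm_smul, hR]; norm_num; ring
  have hR0 : 0 ≤ R := hb ▸ norm_nonneg _
  have hpar := parallelogram_law_with_norm ℝ (w - y) (q - y)
  rw [sub_sub_sub_cancel_right, hb] at hpar
  have h3 : ‖w - y + (q - y)‖ * ‖w - y + (q - y)‖ ≤ 0 := by
    have := mul_self_le_mul_self (norm_nonneg _) h1
    have := mul_self_le_mul_self (by positivity) h2
    linarith
  have h4 : w - y + (q - y) = 0 := norm_eq_zero.1 (mul_self_eq_zero.1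
    (le_antisymm h3 (mul_self_nonneg _)))
  have h5 : w - u = w - y + (q - y) := by rw [hy]; module
  exact sub_eq_zero.1 (h5.trans h4)

variable {Γ : Subgroup (EuclIsom n)} {ξ : OrbitIsom Γ} {g : EuclIsom n} {u : EuclSp n} {r : ℝ}

/-- A local lift of an isometry of the orbit space is a lift on the whole Dirichlet domain. -/
theorem lift_eq_on_dirichlet [DiscreteTopology Γ] (hr : 0 < r)
    (hg : ∀ x ∈ Metric.ball u r, ξ (orbitPt Γ x) = orbitPt Γ (g x)) {x : EuclSp n}
    (hx : dist (orbitPt Γ x) (orbitPt Γ u) = dist x u) : ξ (orbitPt Γ x) = orbitPt Γ (g x) := by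
  rcases eq_or_ne x u with rfl | hne
  · exact hg x (Metric.mem_ball_self hr)
  have hl : 0 < dist x u := dist_pos.2 hne
  -- p lies on the segment from u to x, close enough to u for the local lift to apply.
  set t : ℝ := min (1 / 2) (r / (2 * dist x u)) with ht
  have ht0 : 0 < t := lt_min (by norm_num) (by positivity)
  have ht1 : t ≤ 1 := (min_le_left _ _).trans (by norm_num)
  set p := u + t • (x - u) with hp
  have hpu : dist p u = t * dist x u := by
    rw [hp, dist_eq_norm, add_sub_cancel_left, norm_smul, Real.norm_eq_abs, abs_of_pos ht0,
      dist_eq_norm]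
  have hpx : dist p x = (1 - t) * dist x u := by
    have : p - x = (t - 1) • (x - u) := by rw [hp]; module
    rw [dist_eq_norm, this, norm_smul, Real.norm_eq_abs, abs_of_nonpos (by linarith), neg_sub,
      dist_eq_norm]
  have hpr : p ∈ Metric.ball u r := by
    rw [Metric.mem_ball, hpu]
    calc t * dist x u ≤ r / (2 * dist x u) * dist x u :=
          mul_le_mul_of_nonneg_right (min_le_right _ _) hl.le
      _ = r / 2 := by field_simp
      _ < r := by linarith
  -- z is a point of the orbit ξ(Γx) nearest to g p. Then g⁻¹ z is no farther from p than x is and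
  -- no nearer to u, so it is x.
  obtain ⟨z, hz, hzd⟩ := exists_orbitPt_eq_dist_eq Γ (g p) (ξ (orbitPt Γ x))
  rw [← hg p hpr, ξ.dist_eq] at hzd
  have h1 : dist p (g⁻¹ z) ≤ (1 - t) * dist x u := by
    rw [← g.dist_eq, isom_apply_inv_self, hzd, ← hpx]
    exact dist_orbitPt_le Γ p x
  have h2 : dist x u ≤ dist (g⁻¹ z) u := by
    rw [← g.dist_eq (g⁻¹ z), isom_apply_inv_self, ← hx, ← ξ.dist_eq, ← hz,
      hg u (Metric.mem_ball_self hr)]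
    exact dist_orbitPt_le Γ _ _
  have h3 := eq_of_dist_le_of_le_dist ht0 ht1 h1 h2
  rw [← hz, ← h3, isom_apply_inv_self]

theorem lift_dirichlet [DiscreteTopology Γ] (hr : 0 < r)
    (hg : ∀ x ∈ Metric.ball u r, ξ (orbitPt Γ x) = orbitPt Γ (g x)) {x : EuclSp n}
    (hx : dist (orbitPt Γ x) (orbitPt Γ u) = dist x u) :
    dist (orbitPt Γ (g x)) (orbitPt Γ (g u)) = dist (g x) (g u) := by
  rw [← lift_eq_on_dirichlet hr hg hx, ← hg u (Metric.mem_ball_self hr), ξ.dist_eq, g.dist_eq, hx]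

theorem lift_inv (hg : ∀ x ∈ Metric.ball u r, ξ (orbitPt Γ x) = orbitPt Γ (g x)) :
    ∀ x ∈ Metric.ball (g u) r, ξ⁻¹ (orbitPt Γ x) = orbitPt Γ (g⁻¹ x) := by
  intro x hx
  have hmem : g⁻¹ x ∈ Metric.ball u r := by
    rwa [Metric.mem_ball, ← g.dist_eq, isom_apply_inv_self]
  have h := hg _ hmem
  rw [isom_apply_inv_self] at h
  rw [← h]
  exact ξ.symm_apply_apply _

theorem lift_dirichlet_iff [DiscreteTopology Γ] (hr : 0 < r)
    (hg : ∀ x ∈ Metric.ball u r, ξ (orbitPt Γ x) = orbitPt Γ (g x)) (x : EuclSp n) :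
    dist (orbitPt Γ (g x)) (orbitPt Γ (g u)) = dist (g x) (g u) ↔
      dist (orbitPt Γ x) (orbitPt Γ u) = dist x u := by
  refine ⟨fun h => ?_, lift_dirichlet hr hg⟩
  have := lift_dirichlet hr (lift_inv hg) h
  rwa [isom_inv_apply_self, isom_inv_apply_self] at this

/-- If `x` is closer to `u` than to the other points of its orbit, so are the nearby points. -/
theorem mem_dirichlet_of_near {x y u : EuclSp n} {ρ : ℝ} (hxy : dist x y ≤ ρ / 2)
    (h : ∀ γ ∈ Γ, dist x u ≤ dist x (γ u) ∨ dist y u + ρ ≤ dist y (γ u)) :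
    dist (orbitPt Γ x) (orbitPt Γ u) = dist x u := by
  refine le_antisymm (dist_orbitPt_le Γ x u) (le_dist_orbitPt Γ fun γ hγ => ?_)
  rcases h γ hγ with h | h
  · exact h
  · have h1 := dist_triangle x y u
    have h2 := dist_triangle y x (γ u)
    rw [dist_comm y x] at h2
    linarith

/-- The left vector is |b|² times the component of a + b orthogonal to b. The inequality kills that
component, so a is ±b. -/
theorem eq_of_halfspace_le {a b : EuclSp n} (hab : ‖a‖ = ‖b‖) (hne : a ≠ -b)
    (h : ⟪(‖b‖ ^ 2) • (a + b) - ⟪a + b, b⟫_ℝ • b, a + b⟫_ℝ ≤ 0) : a = b := by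
  have hP : |⟪a, b⟫_ℝ| ≤ ‖b‖ ^ 2 := by
    have := abs_real_inner_le_norm a b
    rwa [hab, ← sq] at this
  rw [abs_le] at hP
  have haa : ⟪a, a⟫_ℝ = ‖b‖ ^ 2 := by rw [real_inner_self_eq_norm_sq, hab]
  have hbb : ⟪b, b⟫_ℝ = ‖b‖ ^ 2 := real_inner_self_eq_norm_sq b
  have hba : ⟪b, a⟫_ℝ = ⟪a, b⟫_ℝ := real_inner_comm a b
  simp only [inner_sub_left, real_inner_smul_left, inner_add_left, inner_add_right, haa, hbb,
    hba] at h
  have hfac : (‖b‖ ^ 2 + ⟪a, b⟫_ℝ) * (‖b‖ ^ 2 - ⟪a, b⟫_ℝ) ≤ 0 := by nlinarith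
  have hadd : ‖a + b‖ ^ 2 = 2 * (‖b‖ ^ 2 + ⟪a, b⟫_ℝ) := by
    rw [norm_add_sq_real, hab]; ring
  have hsub : ‖a - b‖ ^ 2 = 2 * (‖b‖ ^ 2 - ⟪a, b⟫_ℝ) := by
    rw [norm_sub_sq_real, hab]; ring
  have hpos : 0 < ‖b‖ ^ 2 + ⟪a, b⟫_ℝ := by
    refine lt_of_le_of_ne (by linarith) fun h0 => hne ?_
    rw [← h0, mul_zero, sq_eq_zero_iff, norm_eq_zero] at hadd
    exact eq_neg_of_add_eq_zero_left hadd
  have hle : ‖b‖ ^ 2 - ⟪a, b⟫_ℝ ≤ 0 := by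
    by_contra! hlt
    exact absurd hfac (not_le.2 (mul_pos hpos hlt))
  have : ‖a - b‖ ^ 2 = 0 := le_antisymm (by linarith) (sq_nonneg _)
  exact sub_eq_zero.1 (norm_eq_zero.1 (sq_eq_zero_iff.1 this))

/-- A local lift `g` which does not centralise `Γ` maps some short facet-neighbour `γ u` of `u`,
with `γ` not commuting with `g`, into the orbit of `g u`. -/
theorem exists_neighbour_of_not_commute [DiscreteTopology Γ] {c : ℝ}
    (hc : ∀ p q : OrbitSp Γ, dist p q < c) (hr : 0 < r)
    (hg : ∀ x ∈ Metric.ball u r, ξ (orbitPt Γ x) = orbitPt Γ (g x))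
    (hu : ∀ γ ∈ Γ, γ u = u → γ = 1) (hcomm : ¬ ∀ γ ∈ Γ, g * γ = γ * g) :
    ∃ γ ∈ Γ, g * γ ≠ γ * g ∧ dist (γ u) u < 2 * c ∧ ∃ δ ∈ Γ, g (γ u) = δ (g u) := by
  push Not at hcomm
  obtain ⟨γ₀, hγ₀, hne₀⟩ := hcomm
  obtain ⟨γ, ⟨⟨hγ, hγ'⟩, hγc⟩, hmin'⟩ := Set.exists_min_image _
    (fun γ : EuclIsom n => dist u (γ u))
    ((finite_dist_le Γ u u (dist u (γ₀ u))).inter_of_left {γ | g * γ ≠ γ * g})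
    ⟨γ₀, ⟨hγ₀, le_rfl⟩, hne₀⟩
  have hmin : ∀ δ ∈ Γ, g * δ ≠ δ * g → dist (γ u) u ≤ dist (δ u) u := by
    intro δ hδ hδc
    rw [dist_comm (γ u), dist_comm (δ u)]
    by_cases hle : dist u (δ u) ≤ dist u (γ₀ u)
    · exact hmin' δ ⟨⟨hδ, hle⟩, hδc⟩
    · exact hγ'.trans (not_le.1 hle).le
  set R := dist (γ u) u / 2 with hR
  have hR2 : dist (γ u) u = 2 * R := by rw [hR]; ring
  have hγu : γ u ≠ u := fun h => hγc (by rw [hu γ hγ h, mul_one, one_mul])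
  have hRpos : 0 < R := by have := dist_pos.2 hγu; linarith
  set y := (2⁻¹ : ℝ) • (u + γ u) with hy
  set b := (2⁻¹ : ℝ) • (γ u - u) with hb
  have hyu : y = u + b := by rw [hy, hb]; module
  have hyγ : γ u = y + b := by rw [hy, hb]; module
  have hbn : ‖b‖ = R := by
    rw [hb, norm_smul, ← dist_eq_norm, hR2]; norm_num; ring
  have hdyu : dist y u = R := by rw [hyu, dist_eq_norm, add_sub_cancel_left, hbn]
  -- y is the midpoint of u and γ u, and minimality of γ leaves no other orbit point within R of y:
  -- if δ commutes with g, then δ⁻¹ γ does not, so δ u is at least 2R from γ u; if not, δ u is at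
  -- least 2R from u. Thus y is interior to a facet.
  have hclosest : ∀ δ ∈ Γ, dist y (δ u) ≤ R → δ u = u ∨ δ u = γ u := by
    intro δ hδ hle
    rw [dist_comm] at hle
    by_cases hδc : g * δ = δ * g
    · left
      have h1 : g * (δ⁻¹ * γ) ≠ (δ⁻¹ * γ) * g := by
        intro h
        apply hγc
        have h2 : g * δ⁻¹ = δ⁻¹ * g := ((show Commute g δ from hδc).inv_right).eq
        rw [← mul_assoc, h2, mul_assoc, mul_assoc] at h
        exact mul_left_cancel h
      have h2 := hmin _ (Γ.mul_mem (Γ.inv_mem hδ) hγ) h1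
      rw [isom_mul_apply, ← δ.dist_eq (δ⁻¹ _), isom_apply_inv_self, hR2, dist_comm] at h2
      exact eq_of_midpoint hR2 hle h2
    · right
      have h2 := hmin δ hδ hδc
      rw [hR2] at h2
      refine eq_of_midpoint (R := R) (u := γ u) (q := u) (by rw [dist_comm, hR2]) ?_ h2
      rw [add_comm]; exact hle
  have hfar : ∀ δ ∈ Γ, δ u = u ∨ δ u = γ u ∨ R < dist y (δ u) := by
    intro δ hδ
    by_cases hle : dist y (δ u) ≤ R
    · exact (hclosest δ hδ hle).imp_right Or.inl
    · exact Or.inr (Or.inr (not_le.1 hle))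
  have hdyγ : dist y (γ u) = R := by
    rw [hyγ, dist_self_add_right, hbn]
  refine ⟨γ, hγ, hγc, ?_, ?_⟩
  · obtain ⟨δ, hδ, hlt⟩ := (dist_orbitPt_lt_iff Γ y u c).1 (hc _ _)
    have : R < c := by
      rcases hfar δ hδ with h | h | h
      · rwa [h, hdyu] at hlt
      · rwa [h, hdyγ] at hlt
      · exact h.trans hlt
    rw [hR2]; linarith
  obtain ⟨ρ, hρ, hgap⟩ := exists_gap Γ y u R
  have hyD : dist (orbitPt Γ y) (orbitPt Γ u) = dist y u := by
    refine mem_dirichlet_of_near (y := y) (ρ := 0) (by simp) fun δ hδ => Or.inl ?_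
    rcases hfar δ hδ with h | h | h
    · rw [h]
    · rw [h, hdyu, hdyγ]
    · rw [hdyu]; exact h.le
  have hgyD := (lift_dirichlet_iff hr hg y).2 hyD
  rw [g.dist_eq, hdyu] at hgyD
  -- some other point of the orbit of `g u` is as close to `g y` as `g u`
  obtain ⟨δ, hδ, hδne, hδle⟩ : ∃ δ ∈ Γ, δ (g u) ≠ g u ∧ dist (g y) (δ (g u)) ≤ R := by
    by_contra! hcon
    obtain ⟨ρ', hρ', hgap'⟩ := exists_gap Γ (g y) (g u) R
    -- Otherwise y could be pushed across the facet towards γ u while its image stays in the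
    -- Dirichlet domain of g u.
    obtain ⟨s, hs, hsb⟩ : ∃ s > 0, s * R ≤ ρ' / 2 :=
      ⟨ρ' / 2 / R, by positivity, by rw [div_mul_cancel₀ _ hRpos.ne']⟩
    have h1 : dist (orbitPt Γ (g (y + s • b))) (orbitPt Γ (g u)) =
        dist (g (y + s • b)) (g u) := by
      refine mem_dirichlet_of_near (y := g y) (ρ := ρ') ?_ fun δ hδ => ?_
      · rw [g.dist_eq, dist_eq_norm, add_sub_cancel_left, norm_smul, hbn, Real.norm_eq_abs,
          abs_of_pos hs]
        exact hsb
      · by_cases h : δ (g u) = g u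
        · left; rw [h]
        · right
          rw [g.dist_eq, hdyu]
          exact hgap' δ hδ (hcon δ hδ h)
    rw [lift_dirichlet_iff hr hg] at h1
    have h2 := dist_orbitPt_le_smul Γ (y + s • b) u hγ
    rw [h1, hyγ, hyu, dist_eq_norm, dist_eq_norm,
      show u + b + s • b - u = (1 + s) • b by module,
      show u + b + s • b - (u + b + b) = (s - 1) • b by module, norm_smul (1 + s) b, norm_smul (s - 1) b, hbn,
      Real.norm_eq_abs, Real.norm_eq_abs, abs_of_pos (by linarith)] at h2
    have h3 : |s - 1| < 1 + s := abs_lt.2 ⟨by linarith, by linarith⟩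
    nlinarith
  refine ⟨δ, hδ, ?_⟩
  -- The Dirichlet domain of u lies in the half-space of points no nearer to g⁻¹ δ g u than to u.
  have hmem : ∀ x, dist (orbitPt Γ x) (orbitPt Γ u) = dist x u →
      dist x u ≤ dist x (g⁻¹ (δ (g u))) := by
    intro x hx
    have h1 := (lift_dirichlet_iff hr hg x).2 hx
    rw [← g.dist_eq x u, ← h1, ← g.dist_eq x (g⁻¹ _), isom_apply_inv_self]
    exact dist_orbitPt_le_smul Γ _ _ hδ
  set a := g⁻¹ (δ (g u)) - y with ha
  have hqa : g⁻¹ (δ (g u)) = y + a := by rw [ha]; abel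
  have han : ‖a‖ = ‖b‖ := by
    have h1 := hmem y hyD
    rw [hdyu, hqa, dist_self_add_right] at h1
    rw [← isom_apply_inv_self g (δ (g u)), g.dist_eq, hqa, dist_self_add_right] at hδle
    rw [hbn]; exact le_antisymm hδle h1
  have hab : a ≠ -b := by
    intro h
    apply hδne
    rw [← isom_apply_inv_self g (δ (g u)), hqa, h, hyu, add_neg_cancel_right]
  -- Motion along v, orthogonal to b, stays equidistant from u = y - b and γ u = y + b, hence in the
  -- Dirichlet domain for a short time. The half-space of y + a then gives ⟪v, a + b⟫ ≤ 0, so a = b.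
  set v := (‖b‖ ^ 2) • (a + b) - ⟪a + b, b⟫_ℝ • b with hv
  have hvb : ⟪v, b⟫_ℝ = 0 := by
    rw [hv, inner_sub_left, real_inner_smul_left, real_inner_smul_left,
      real_inner_self_eq_norm_sq]
    ring
  obtain ⟨s, hs, hsb⟩ : ∃ s > 0, s * ‖v‖ ≤ ρ / 2 := by
    refine ⟨ρ / 2 / (‖v‖ + 1), by positivity, ?_⟩
    rw [div_mul_eq_mul_div, div_le_iff₀ (by positivity)]
    exact mul_le_mul_of_nonneg_left (by linarith) (by positivity)
  have hxu : dist (y + s • v) u = ‖s • v + b‖ := by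
    rw [dist_eq_norm, hyu]; congr 1; abel
  have hxD : dist (orbitPt Γ (y + s • v)) (orbitPt Γ u) = dist (y + s • v) u := by
    refine mem_dirichlet_of_near (y := y) (ρ := ρ) ?_ fun δ hδ => ?_
    · rw [dist_eq_norm, add_sub_cancel_left, norm_smul, Real.norm_eq_abs, abs_of_pos hs]
      exact hsb
    · rcases hfar δ hδ with h | h | h
      · left; rw [h]
      · left
        rw [h, hxu, hyγ, dist_eq_norm, add_sub_add_left_eq_sub]
        refine le_of_sq_le_sq ?_ (norm_nonneg _)
        rw [norm_add_sq_real, norm_sub_sq_real, real_inner_smul_left, hvb]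
        linarith
      · right; rw [hdyu]; exact hgap δ hδ h
  have h1 := hmem _ hxD
  rw [hxu, hqa, dist_eq_norm, add_sub_add_left_eq_sub] at h1
  have h2 := pow_le_pow_left₀ (norm_nonneg _) h1 2
  rw [norm_add_sq_real, norm_sub_sq_real, real_inner_smul_left, real_inner_smul_left, han] at h2
  have h3 : ⟪v, a + b⟫_ℝ ≤ 0 := by
    rw [inner_add_right]
    have : s * (⟪v, a⟫_ℝ + ⟪v, b⟫_ℝ) ≤ 0 := by linarith
    exact nonpos_of_mul_nonpos_right this hs
  have h4 := eq_of_halfspace_le han hab h3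
  rw [← isom_apply_inv_self g (δ (g u)), hqa, h4, ← hyγ]

end Lifting

/-! ### Translations of the orbit space -/

section OrbitTranslation

variable {n : ℕ} (Γ : Subgroup (EuclIsom n))

theorem add_isom_of_mem_centerSpan (v : centerSpan Γ) {γ : EuclIsom n} (hγ : γ ∈ Γ)
    (x : EuclSp n) : γ ((v : EuclSp n) + x) = (v : EuclSp n) + γ x := by
  rw [isom_apply, map_add, linPart_of_mem_centerSpan Γ v.2 hγ, add_assoc, ← isom_apply]

/-- The map `Γx ↦ Γ(v + x)` of the orbit space, for `v` in the span of the center. -/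
noncomputable def orbitAdd (v : centerSpan Γ) : OrbitSp Γ → OrbitSp Γ :=
  Quotient.lift (fun x => orbitPt Γ ((v : EuclSp n) + x)) (by
    rintro _ x ⟨γ, rfl⟩
    exact (orbitPt_eq_iff Γ).2 ⟨γ, γ.2, add_isom_of_mem_centerSpan Γ v γ.2 x⟩)

theorem orbitAdd_orbitPt (v : centerSpan Γ) (x : EuclSp n) :
    orbitAdd Γ v (orbitPt Γ x) = orbitPt Γ ((v : EuclSp n) + x) := rfl

theorem orbitAdd_add (v w : centerSpan Γ) (q : OrbitSp Γ) :
    orbitAdd Γ (v + w) q = orbitAdd Γ v (orbitAdd Γ w q) := by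
  obtain ⟨x, rfl⟩ := orbitPt_surjective Γ q
  simp only [orbitAdd_orbitPt, Submodule.coe_add, add_assoc]

theorem orbitAdd_zero (q : OrbitSp Γ) : orbitAdd Γ 0 q = q := by
  obtain ⟨x, rfl⟩ := orbitPt_surjective Γ q
  simp only [orbitAdd_orbitPt, Submodule.coe_zero, zero_add]

theorem orbitAdd_isometry (v : centerSpan Γ) : Isometry (orbitAdd Γ v) := by
  refine Isometry.of_dist_eq fun p q => ?_
  obtain ⟨x, rfl⟩ := orbitPt_surjective Γ p
  obtain ⟨y, rfl⟩ := orbitPt_surjective Γ q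
  refine iInf_congr fun γ => ?_
  change dist ((v : EuclSp n) + x) ((γ : EuclIsom n) ((v : EuclSp n) + y)) = _
  rw [add_isom_of_mem_centerSpan Γ v γ.2, dist_add_left]
  rfl

/-- The isometry `Γx ↦ Γ(v + x)` of the orbit space. -/
noncomputable def orbitTranslation (v : centerSpan Γ) : OrbitIsom Γ where
  toFun := orbitAdd Γ v
  invFun := orbitAdd Γ (-v)
  left_inv q := by rw [← orbitAdd_add, neg_add_cancel, orbitAdd_zero]
  right_inv q := by rw [← orbitAdd_add, add_neg_cancel, orbitAdd_zero]
  isometry_toFun := orbitAdd_isometry Γ v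

theorem orbitTranslation_orbitPt (v : centerSpan Γ) (x : EuclSp n) :
    orbitTranslation Γ v (orbitPt Γ x) = orbitPt Γ ((v : EuclSp n) + x) := rfl

theorem orbitTranslation_add (v w : centerSpan Γ) :
    orbitTranslation Γ (v + w) = orbitTranslation Γ v * orbitTranslation Γ w :=
  IsometryEquiv.ext (orbitAdd_add Γ v w)

theorem orbitTranslation_zero : orbitTranslation Γ 0 = 1 :=
  IsometryEquiv.ext (orbitAdd_zero Γ)

theorem dist_orbitTranslation_le (v : centerSpan Γ) (q : OrbitSp Γ) :
    dist (orbitTranslation Γ v q) q ≤ ‖v‖ := by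
  obtain ⟨x, rfl⟩ := orbitPt_surjective Γ q
  rw [orbitTranslation_orbitPt]
  refine (dist_orbitPt_le Γ _ _).trans ?_
  rw [dist_eq_norm, add_sub_cancel_right]
  rfl

/-- At a point with trivial stabiliser the displacement recovers the norm of a short vector. -/
theorem exists_dist_orbitTranslation_eq [DiscreteTopology Γ] :
    ∃ (p : OrbitSp Γ) (r : ℝ), 0 < r ∧ ∀ v : centerSpan Γ, ‖v‖ < r →
      dist (orbitTranslation Γ v p) p = ‖v‖ := by
  obtain ⟨x₀, r, hr, hsep⟩ := exists_regular_separation Γ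
  refine ⟨orbitPt Γ x₀, r, hr, fun v hv => ?_⟩
  rw [orbitTranslation_orbitPt, dist_orbitPt_eq_of_mem_ball hsep ?_ (Metric.mem_ball_self hr),
    dist_eq_norm, add_sub_cancel_right]
  · rfl
  · rw [mem_ball_iff_norm, add_sub_cancel_right]
    exact hv

theorem orbitTranslation_eq_one_iff [DiscreteTopology Γ] (v : centerSpan Γ) :
    orbitTranslation Γ v = 1 ↔ v ∈ centerLattice Γ := by
  rw [mem_centerLattice, euclTranslation_mem_centerIn]
  constructor
  · intro h
    refine ⟨?_, fun γ hγ => linPart_of_mem_centerSpan Γ v.2 hγ⟩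
    by_contra hmem
    -- If the translation is not in Γ, a generic x is not moved by it within its own orbit.
    obtain ⟨x, -, hx⟩ := exists_forall_apply_ne
      (S := (fun γ : EuclIsom n => (γ, euclTranslation (v : EuclSp n))) '' {γ | γ ∈ Γ})
      ((countable_of_discrete Γ).image _)
      (by
        rintro _ ⟨γ, hγ, rfl⟩ he
        have he' : γ = euclTranslation (v : EuclSp n) := he
        exact hmem (he' ▸ hγ)) isOpen_univ Set.univ_nonempty
    have h1 : orbitPt Γ ((v : EuclSp n) + x) = orbitPt Γ x :=
      congrArg (fun f : OrbitIsom Γ => f (orbitPt Γ x)) h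
    obtain ⟨γ, hγ, h2⟩ := (orbitPt_eq_iff Γ).1 h1
    exact hx _ ⟨γ, hγ, rfl⟩ h2
  · rintro ⟨h, -⟩
    refine IsometryEquiv.ext fun q => ?_
    obtain ⟨x, rfl⟩ := orbitPt_surjective Γ q
    exact orbitPt_smul Γ h x

variable [DiscreteTopology Γ] [CompactSpace (OrbitSp Γ)]

/-- Every isometry of the orbit space close to the identity is the translation by a short vector
of the span of the center. -/
theorem exists_orbitTranslation_eq :
    ∃ η > 0, ∀ ε ≤ η, ∀ ξ : OrbitIsom Γ, (∀ q, dist (ξ q) q < ε) →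
      ∃ v : centerSpan Γ, ‖v‖ < ε ∧ ξ = orbitTranslation Γ v := by
  obtain ⟨x₀, r, hr, hsep⟩ := exists_regular_separation Γ
  obtain ⟨c, hc, hdiam⟩ := exists_codiameter Γ
  -- M bounds the distance from x₀ to the points u and γ u used below; κ is the factor by which
  -- closeness to the identity deteriorates from the small ball to radius M.
  set M := 2 * c + r with hM
  set κ := 1 + 8 * M / r with hκ
  have hMpos : 0 < M := by positivity
  have hκ1 : 1 ≤ κ := by rw [hκ]; have : 0 ≤ 8 * M / r := by positivity
                         linarith
  refine ⟨min (r / 2) (r / κ), lt_min (by positivity) (by positivity), fun ε hε ξ hξ => ?_⟩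
  have hεr : ε ≤ r / 2 := hε.trans (min_le_left _ _)
  have hεκ : κ * ε ≤ r := by
    have := hε.trans (min_le_right _ _)
    rw [le_div_iff₀ (by positivity)] at this
    linarith
  -- f x is a point of the orbit ξ(Γx) nearest to x. On a small ball f is isometric, since there the
  -- projection to Eⁿ/Γ is.
  choose f hf1 hf2 using fun x => exists_orbitPt_eq_dist_eq Γ x (ξ (orbitPt Γ x))
  have hf3 : ∀ x, dist (f x) x < ε := fun x => by
    rw [dist_comm, hf2, dist_comm]; exact hξ _
  have hfball : ∀ x ∈ Metric.ball x₀ (r / 2), f x ∈ Metric.ball x₀ r := fun x hx => by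
    have := dist_triangle (f x) x x₀
    have := hf3 x
    rw [Metric.mem_ball] at *
    linarith
  have hsub : Metric.ball x₀ (r / 2) ⊆ Metric.ball x₀ r := Metric.ball_subset_ball (by linarith)
  obtain ⟨A, hA⟩ := exists_linearIsometryEquiv_of_isometric_ball (half_pos hr) (f := f)
    (fun x hx y hy => by
      rw [← dist_orbitPt_eq_of_mem_ball hsep (hfball x hx) (hfball y hy), hf1, hf1, ξ.dist_eq,
        dist_orbitPt_eq_of_mem_ball hsep (hsub hx) (hsub hy)])
  let g : EuclIsom n := euclTranslation (f x₀ - A x₀) * A.toIsometryEquiv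
  have hgf : ∀ x ∈ Metric.ball x₀ (r / 2), g x = f x := fun x hx => by
    rw [hA x hx, map_sub]
    change f x₀ - A x₀ + A x = _
    abel
  have hg : ∀ x ∈ Metric.ball x₀ (r / 2), ξ (orbitPt Γ x) = orbitPt Γ (g x) := fun x hx => by
    rw [hgf x hx, hf1]
  have hx₀ : x₀ ∈ Metric.ball x₀ (r / 2) := Metric.mem_ball_self (half_pos hr)
  have hgx₀ : ‖g x₀ - x₀‖ < ε := by rw [hgf x₀ hx₀, ← dist_eq_norm]; exact hf3 x₀
  have hε0 : 0 < ε := (norm_nonneg _).trans_lt hgx₀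
  have hdec : ∀ z, g z - z = linDev g (z - x₀) + (g x₀ - x₀) := fun z => by
    rw [isom_sub_self, isom_sub_self, map_sub]; abel
  have hgnear : ∀ z, dist z x₀ ≤ M → dist (g z) z ≤ κ * ε := by
    intro z hz
    -- z - x₀ is shrunk into the ball where g = f moves points by less than ε, and linearity of
    -- `linDev g` scales the bound back up.
    set w := (r / (4 * M)) • (z - x₀) with hw
    have hwn : ‖w‖ ≤ r / 4 := by
      rw [hw, norm_smul, ← dist_eq_norm, Real.norm_eq_abs, abs_of_pos (by positivity)]
      calc r / (4 * M) * dist z x₀ ≤ r / (4 * M) * M := by gcongr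
        _ = r / 4 := by field_simp
    have h1 : x₀ + w ∈ Metric.ball x₀ (r / 2) := by
      rw [mem_ball_iff_norm, add_sub_cancel_left]; linarith
    have h2 := hdec (x₀ + w)
    rw [add_sub_cancel_left, hgf _ h1] at h2
    have h3 : ‖linDev g w‖ ≤ 2 * ε := by
      rw [← sub_eq_iff_eq_add] at h2
      rw [← h2]
      have := norm_sub_le (f (x₀ + w) - (x₀ + w)) (g x₀ - x₀)
      have := hf3 (x₀ + w)
      rw [dist_eq_norm] at this
      linarith
    have h4 : linDev g (z - x₀) = (4 * M / r) • linDev g w := by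
      rw [← map_smul, hw, smul_smul]
      have : 4 * M / r * (r / (4 * M)) = 1 := by field_simp
      rw [this, one_smul]
    rw [dist_eq_norm, hdec, h4]
    refine (norm_add_le _ _).trans ?_
    rw [norm_smul, Real.norm_eq_abs, abs_of_pos (by positivity)]
    have h5 : 4 * M / r * ‖linDev g w‖ ≤ 4 * M / r * (2 * ε) := by gcongr
    have h6 : κ * ε = ε + 4 * M / r * (2 * ε) := by rw [hκ]; ring
    linarith
  have hcomm : ∀ γ ∈ Γ, g * γ = γ * g := by
    by_contra hcon
    -- u is generic: gγu ≠ γgu for every γ that does not commute with g.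
    obtain ⟨u, hu, hune⟩ := exists_forall_apply_ne
      (S := (fun γ : EuclIsom n => (g * γ, γ * g)) '' {γ | γ ∈ Γ ∧ g * γ ≠ γ * g})
      (((countable_of_discrete Γ).mono fun γ h => h.1).image _)
      (by rintro _ ⟨γ, h, rfl⟩; exact h.2) (U := Metric.ball x₀ (r / 4)) Metric.isOpen_ball
      ⟨x₀, Metric.mem_ball_self (by positivity)⟩
    rw [Metric.mem_ball] at hu
    have hudisp : ∀ γ ∈ Γ, γ ≠ 1 → 3 * r ≤ dist u (γ u) := fun γ hγ hne => by
      have h1 := hsep γ hγ hne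
      have h2 := dist_triangle4 x₀ u (γ u) (γ x₀)
      rw [γ.dist_eq, dist_comm x₀ u] at h2
      linarith
    have hball : Metric.ball u (r / 4) ⊆ Metric.ball x₀ (r / 2) := fun x hx => by
      have := dist_triangle x u x₀
      rw [Metric.mem_ball] at *
      linarith
    obtain ⟨γ, hγ, hγc, hγu, δ, hδ, hδu⟩ := exists_neighbour_of_not_commute hdiam
      (r := r / 4) (by positivity) (fun x hx => hg x (hball hx)) (fun γ hγ h => by
        by_contra hne
        have := hudisp γ hγ hne
        rw [h, dist_self] at this
        linarith) hcon
    have h1 := hgnear u (by linarith)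
    have h2 := hgnear (γ u) (by have := dist_triangle (γ u) u x₀; linarith)
    have h3 : dist (δ u) (γ u) ≤ 2 * r := by
      have := dist_triangle (δ u) (δ (g u)) (γ u)
      rw [δ.dist_eq, dist_comm u, ← hδu] at this
      linarith
    -- δ u and γ u are within 2r, whereas nontrivial elements move u by at least 3r.
    have h4 : δ⁻¹ * γ = 1 := by
      by_contra hne
      have h5 := hudisp _ (Γ.mul_mem (Γ.inv_mem hδ) hγ) hne
      rw [isom_mul_apply, ← δ.dist_eq, isom_apply_inv_self] at h5
      linarith
    rw [inv_mul_eq_one] at h4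
    rw [h4] at hδu
    exact hune _ ⟨γ, ⟨hγ, hγc⟩, rfl⟩ hδu
  have hgt := eq_euclTranslation (linPart_eq_one_of_commute Γ hcomm)
  set a := g 0 with ha
  have hamem : a ∈ centerSpan Γ := (mem_centerSpan_iff Γ).2 fun γ hγ =>
    (commute_euclTranslation_iff γ a).1 (by rw [← hgt]; exact (hcomm γ hγ).symm)
  refine ⟨⟨a, hamem⟩, ?_, IsometryEquiv.ext fun q => ?_⟩
  · have : g x₀ - x₀ = a := by rw [hgt, euclTranslation_apply, add_sub_cancel_right]
    rw [this] at hgx₀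
    exact hgx₀
  · obtain ⟨y, rfl, hy⟩ := exists_orbitPt_eq_dist_eq Γ x₀ q
    rw [lift_eq_on_dirichlet (half_pos hr) hg (by rw [dist_comm, ← hy, dist_comm]), hgt]
    rfl

/-- The translations of the orbit space are normalised by every isometry, which acts on the
translation vectors by a linear map. -/
theorem exists_conj_orbitTranslation (k : OrbitIsom Γ) :
    ∃ A : centerSpan Γ →L[ℝ] centerSpan Γ, ∀ v,
      k⁻¹ * orbitTranslation Γ v * k = orbitTranslation Γ (A v) := by
  obtain ⟨p, r, hr, hp⟩ := exists_dist_orbitTranslation_eq Γ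
  obtain ⟨η, hη, hopen⟩ := exists_orbitTranslation_eq Γ
  have hdisp : ∀ (h : OrbitIsom Γ) (v : centerSpan Γ) (q : OrbitSp Γ),
      dist ((h⁻¹ * orbitTranslation Γ v * h) q) q ≤ ‖v‖ := fun h v q => by
    rw [← h.dist_eq]
    refine le_of_eq_of_le ?_ (dist_orbitTranslation_le Γ v (h q))
    congr 1
    exact h.apply_symm_apply _
  have hle : ∀ (h : OrbitIsom Γ) (v w : centerSpan Γ), ‖w‖ < r →
      h⁻¹ * orbitTranslation Γ v * h = orbitTranslation Γ w → ‖w‖ ≤ ‖v‖ := fun h v w hw e => by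
    rw [← hp w hw, ← e]
    exact hdisp h v p
  have hnorm : ∀ v w : centerSpan Γ, ‖v‖ < r → ‖w‖ < r →
      k⁻¹ * orbitTranslation Γ v * k = orbitTranslation Γ w → ‖w‖ = ‖v‖ := fun v w hv hw e =>
    le_antisymm (hle k v w hw e) (hle k⁻¹ w v hv (by rw [← e]; group))
  -- Conjugates of translations shorter than η are again short translations; the bound r / 2 keeps
  -- differences of two vectors below r, where displacement determines the norm.
  set ρ := min η (r / 2) with hρ
  have hρ0 : 0 < ρ := lt_min hη (half_pos hr)
  have hρr : ρ ≤ r / 2 := min_le_right _ _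
  have hex : ∀ v : centerSpan Γ, ∃ w : centerSpan Γ, v ∈ Metric.ball (0 : centerSpan Γ) ρ →
      ‖w‖ < ρ ∧ k⁻¹ * orbitTranslation Γ v * k = orbitTranslation Γ w := by
    intro v
    by_cases hv : v ∈ Metric.ball (0 : centerSpan Γ) ρ
    · obtain ⟨w, h⟩ := hopen ρ (min_le_left _ _) (k⁻¹ * orbitTranslation Γ v * k)
        fun q => (hdisp k v q).trans_lt (mem_ball_zero_iff.1 hv)
      exact ⟨w, fun _ => h⟩
    · exact ⟨0, fun h => absurd h hv⟩
  choose f hf using hex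
  have hsub : ∀ v w : centerSpan Γ,
      orbitTranslation Γ (v - w) = orbitTranslation Γ v * (orbitTranslation Γ w)⁻¹ := by
    intro v w
    rw [eq_mul_inv_iff_mul_eq, ← orbitTranslation_add, sub_add_cancel]
  obtain ⟨A, hA⟩ := exists_linearIsometryEquiv_of_isometric_ball (x₀ := (0 : centerSpan Γ)) hρ0
    (f := f) (fun v hv w hw => by
      obtain ⟨h1, h2⟩ := hf v hv
      obtain ⟨h3, h4⟩ := hf w hw
      rw [mem_ball_zero_iff] at hv hw
      rw [dist_eq_norm, dist_eq_norm]
      refine hnorm _ _ ?_ ?_ ?_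
      · have := norm_sub_le v w; linarith
      · have := norm_sub_le (f v) (f w); linarith
      · rw [hsub, hsub, ← h2, ← h4]; group)
  have hmem0 : (0 : centerSpan Γ) ∈ Metric.ball (0 : centerSpan Γ) ρ := Metric.mem_ball_self hρ0
  have hf0 : f 0 = 0 := by
    obtain ⟨h1, h2⟩ := hf 0 hmem0
    have := hle k 0 (f 0) (by linarith) h2
    rw [norm_zero] at this
    exact norm_le_zero_iff.1 this
  have hball : ∀ v ∈ Metric.ball (0 : centerSpan Γ) ρ,
      k⁻¹ * orbitTranslation Γ v * k = orbitTranslation Γ (A v) := fun v hv => by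
    rw [(hf v hv).2, hA v hv, hf0, zero_add, sub_zero]
  refine ⟨A.toContinuousLinearEquiv, fun v => ?_⟩
  -- A long vector is an integer multiple of one in the ball, and conjugation respects powers.
  have hpow : ∀ (m : ℕ) (w : centerSpan Γ),
      orbitTranslation Γ (m • w) = orbitTranslation Γ w ^ m := by
    intro m w
    induction m with
    | zero => rw [zero_smul, pow_zero, orbitTranslation_zero]
    | succ m ih => rw [succ_nsmul, pow_succ, orbitTranslation_add, ih]
  obtain ⟨m, hm⟩ := exists_nat_gt (‖v‖ / ρ)
  have hm0 : (0 : ℝ) < m := (by positivity : 0 ≤ ‖v‖ / ρ).trans_lt hm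
  set w := (m : ℝ)⁻¹ • v with hw
  have hv : v = m • w := by
    rw [hw, ← Nat.cast_smul_eq_nsmul ℝ, smul_inv_smul₀ hm0.ne']
  have hwb : w ∈ Metric.ball (0 : centerSpan Γ) ρ := by
    rw [mem_ball_zero_iff, hw, norm_smul, norm_inv, Real.norm_natCast,
      inv_mul_lt_iff₀ hm0]
    rwa [div_lt_iff₀ hρ0] at hm
  change _ = orbitTranslation Γ (A v)
  rw [hv, map_nsmul, hpow, hpow, ← hball w hwb]
  have := conj_pow (i := m) (a := k⁻¹) (b := orbitTranslation Γ w)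
  rw [inv_inv] at this
  exact this.symm

end OrbitTranslation

/-! ### Lie group structures from local parametrisations -/

section LieStructure

open Filter Topology

/-- A homomorphism from the additive group of a normed space to a topological group which is a
homeomorphism from a neighbourhood `U` of `0` onto a neighbourhood of `1`. -/
structure IsLocalParam {E G : Type*} [NormedAddCommGroup E] [Group G] [TopologicalSpace G]
    (ψ : E → G) (U : Set E) : Prop where
  map_add : ∀ v w, ψ (v + w) = ψ v * ψ w
  continuous : Continuous ψ
  isOpenMap : IsOpenMap ψ
  isOpen : IsOpen U
  zero_mem : (0 : E) ∈ U
  injOn : Set.InjOn ψ U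

variable {E G : Type*} [NormedAddCommGroup E] [Group G] [TopologicalSpace G]
  {ψ : E → G} {U : Set E}

namespace IsLocalParam

theorem map_zero (hψ : IsLocalParam ψ U) : ψ 0 = 1 := by
  have := hψ.map_add 0 0
  rwa [add_zero, left_eq_mul] at this

theorem map_neg (hψ : IsLocalParam ψ U) (v : E) : ψ (-v) = (ψ v)⁻¹ := by
  rw [eq_inv_iff_mul_eq_one, ← hψ.map_add, neg_add_cancel, hψ.map_zero]

/-- The parametrisation as a partial homeomorphism. -/
noncomputable def partialHomeo (hψ : IsLocalParam ψ U) : OpenPartialHomeomorph E G :=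
  OpenPartialHomeomorph.ofContinuousOpen (Set.InjOn.toPartialEquiv ψ U hψ.injOn)
    hψ.continuous.continuousOn hψ.isOpenMap hψ.isOpen

variable [IsTopologicalGroup G]

/-- The chart `h * ψ v ↦ v` around `h`. -/
noncomputable def chart (hψ : IsLocalParam ψ U) (h : G) : OpenPartialHomeomorph G E :=
  (Homeomorph.mulLeft h⁻¹).transOpenPartialHomeomorph hψ.partialHomeo.symm

theorem chart_symm_apply (hψ : IsLocalParam ψ U) (h : G) (v : E) :
    (hψ.chart h).symm v = h * ψ v := by
  change (h⁻¹)⁻¹ * ψ v = _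
  rw [inv_inv]

theorem mul_chart (hψ : IsLocalParam ψ U) {h x : G} (hx : x ∈ (hψ.chart h).source) :
    h * ψ (hψ.chart h x) = x := by
  rw [← hψ.chart_symm_apply, (hψ.chart h).left_inv hx]

theorem chart_mem (hψ : IsLocalParam ψ U) {h x : G} (hx : x ∈ (hψ.chart h).source) :
    hψ.chart h x ∈ U := (hψ.chart h).map_source hx

theorem mul_mem_source (hψ : IsLocalParam ψ U) (h : G) {v : E} (hv : v ∈ U) :
    h * ψ v ∈ (hψ.chart h).source := by
  rw [← chart_symm_apply]; exact (hψ.chart h).map_target hv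

theorem chart_mul (hψ : IsLocalParam ψ U) (h : G) {v : E} (hv : v ∈ U) :
    hψ.chart h (h * ψ v) = v := by
  rw [← chart_symm_apply]; exact (hψ.chart h).right_inv hv

theorem mem_chart_source (hψ : IsLocalParam ψ U) (h : G) : h ∈ (hψ.chart h).source := by
  have := hψ.mul_mem_source h hψ.zero_mem
  rwa [hψ.map_zero, mul_one] at this

/-- In a chart, the curve `v ↦ a * ψ v` is locally a translation. -/
theorem eventually_chart_mul (hψ : IsLocalParam ψ U) (a h : G) {v₀ : E}
    (hv₀ : a * ψ v₀ ∈ (hψ.chart h).source) :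
    ∀ᶠ v in 𝓝 v₀, hψ.chart h (a * ψ v) = hψ.chart h (a * ψ v₀) + (v - v₀) := by
  set w := hψ.chart h (a * ψ v₀) with hw
  have hcont : Continuous fun v : E => w + (v - v₀) := by fun_prop
  have hmem : w + (v₀ - v₀) ∈ U := by rw [sub_self, add_zero]; exact hψ.chart_mem hv₀
  filter_upwards [hcont.continuousAt.eventually_mem (hψ.isOpen.mem_nhds hmem)] with v hv
  have : a * ψ v = h * ψ (w + (v - v₀)) := by
    rw [hψ.map_add, ← mul_assoc, hψ.mul_chart hv₀, mul_assoc, ← hψ.map_add, add_sub_cancel]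
  rw [this, hψ.chart_mul h hv]

/-- The charted space structure given by the charts `h * ψ v ↦ v`. -/
@[reducible] noncomputable def chartedSpace (hψ : IsLocalParam ψ U) : ChartedSpace E G where
  atlas := Set.range hψ.chart
  chartAt := hψ.chart
  mem_chart_source := hψ.mem_chart_source
  chart_mem_atlas h := ⟨h, rfl⟩

variable [NormedSpace ℝ E]

/-- Transition maps are locally translations of E. -/
theorem isManifold (hψ : IsLocalParam ψ U) :
    letI := hψ.chartedSpace
    IsManifold 𝓘(ℝ, E) ∞ G := by
  let := hψ.chartedSpace
  refine isManifold_of_contDiffOn _ _ _ ?_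
  rintro _ _ ⟨a, rfl⟩ ⟨h, rfl⟩
  simp only [modelWithCornersSelf_coe, modelWithCornersSelf_coe_symm, Function.comp_id,
    Function.id_comp, Set.preimage_id, Set.range_id, Set.inter_univ]
  rintro v₀ ⟨h1, h2⟩
  refine ContDiffAt.contDiffWithinAt ?_
  have h3 := hψ.eventually_chart_mul a h (v₀ := v₀) (by rw [← hψ.chart_symm_apply]; exact h2)
  refine ContDiffAt.congr_of_eventuallyEq (f := fun v => hψ.chart h (a * ψ v₀) + (v - v₀))
    (by fun_prop) ?_
  filter_upwards [h3] with v hv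
  rw [OpenPartialHomeomorph.coe_trans, Function.comp_apply, hψ.chart_symm_apply, hv]

theorem contMDiffOn_chart (hψ : IsLocalParam ψ U) (h : G) :
    letI := hψ.chartedSpace
    ContMDiffOn 𝓘(ℝ, E) 𝓘(ℝ, E) ∞ (hψ.chart h) (hψ.chart h).source := by
  let := hψ.chartedSpace
  have := hψ.isManifold
  exact contMDiffOn_of_mem_maximalAtlas (IsManifold.subset_maximalAtlas ⟨h, rfl⟩)

theorem contMDiffAt_chart (hψ : IsLocalParam ψ U) (h : G) :
    letI := hψ.chartedSpace
    ContMDiffAt 𝓘(ℝ, E) 𝓘(ℝ, E) ∞ (hψ.chart h) h := by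
  let := hψ.chartedSpace
  exact (hψ.contMDiffOn_chart h).contMDiffAt
    ((hψ.chart h).open_source.mem_nhds (hψ.mem_chart_source h))

theorem contMDiff_mul_param (hψ : IsLocalParam ψ U) (a : G) :
    letI := hψ.chartedSpace
    ContMDiff 𝓘(ℝ, E) 𝓘(ℝ, E) ∞ (fun v => a * ψ v) := by
  let := hψ.chartedSpace
  have := hψ.isManifold
  intro v₀
  have h1 : ContMDiffOn 𝓘(ℝ, E) 𝓘(ℝ, E) ∞ (hψ.chart (a * ψ v₀)).symm U :=
    contMDiffOn_symm_of_mem_maximalAtlas (IsManifold.subset_maximalAtlas ⟨a * ψ v₀, rfl⟩)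
  have h2 : ContMDiffAt 𝓘(ℝ, E) 𝓘(ℝ, E) ∞ (hψ.chart (a * ψ v₀)).symm (v₀ - v₀) :=
    h1.contMDiffAt (hψ.isOpen.mem_nhds (by rw [sub_self]; exact hψ.zero_mem))
  have h3 : ContMDiffAt 𝓘(ℝ, E) 𝓘(ℝ, E) ∞ (fun v : E => v - v₀) v₀ :=
    (contDiff_id.sub contDiff_const).contMDiff.contMDiffAt
  have h4 := ContMDiffAt.comp (f := fun v : E => v - v₀) v₀ h2 h3
  refine h4.congr_of_eventuallyEq (Eventually.of_forall fun v => ?_)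
  rw [Function.comp_apply, hψ.chart_symm_apply, mul_assoc, ← hψ.map_add, add_sub_cancel]

/-- If conjugation acts on the parameters by linear maps, the charts form a Lie group. -/
theorem lieGroup (hψ : IsLocalParam ψ U)
    (hconj : ∀ k : G, ∃ A : E →L[ℝ] E, ∀ v, k⁻¹ * ψ v * k = ψ (A v)) :
    letI := hψ.chartedSpace
    LieGroup 𝓘(ℝ, E) ∞ G := by
  let := hψ.chartedSpace
  have hman := hψ.isManifold
  have hmul : ContMDiff (𝓘(ℝ, E).prod 𝓘(ℝ, E)) 𝓘(ℝ, E) ∞ fun p : G × G => p.1 * p.2 := by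
    rintro ⟨h, k⟩
    obtain ⟨A, hA⟩ := hconj k
    -- In charts, (h ψ(a))(k ψ(b)) = hk ψ(A a + b), where A is conjugation by k.
    have h1 : ContMDiffAt (𝓘(ℝ, E).prod 𝓘(ℝ, E)) 𝓘(ℝ, E) ∞
        (fun p : G × G => A (hψ.chart h p.1) + hψ.chart k p.2) (h, k) :=
      (A.contMDiff.contMDiffAt.comp (h, k)
        ((hψ.contMDiffAt_chart h).comp (h, k) contMDiffAt_fst)).add
        ((hψ.contMDiffAt_chart k).comp (h, k) contMDiffAt_snd)
    have h2 := (hψ.contMDiff_mul_param (h * k)).contMDiffAt.comp (h, k) h1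
    refine h2.congr_of_eventuallyEq ?_
    have hn : (hψ.chart h).source ×ˢ (hψ.chart k).source ∈ 𝓝 (h, k) :=
      prod_mem_nhds ((hψ.chart h).open_source.mem_nhds (hψ.mem_chart_source h))
        ((hψ.chart k).open_source.mem_nhds (hψ.mem_chart_source k))
    filter_upwards [hn] with p hp
    change p.1 * p.2 = h * k * ψ (A (hψ.chart h p.1) + hψ.chart k p.2)
    rw [hψ.map_add, ← hA]
    calc p.1 * p.2 = (h * ψ (hψ.chart h p.1)) * (k * ψ (hψ.chart k p.2)) := by
          rw [hψ.mul_chart hp.1, hψ.mul_chart hp.2]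
      _ = _ := by group
  have hinv : ContMDiff 𝓘(ℝ, E) 𝓘(ℝ, E) ∞ fun x : G => x⁻¹ := by
    intro h
    obtain ⟨A, hA⟩ := hconj h⁻¹
    -- Likewise (h ψ(a))⁻¹ = h⁻¹ ψ(-A a), where A is now conjugation by h⁻¹.
    have h1 : ContMDiffAt 𝓘(ℝ, E) 𝓘(ℝ, E) ∞ (fun x : G => (-A) (hψ.chart h x)) h :=
      (-A).contMDiff.contMDiffAt.comp h (hψ.contMDiffAt_chart h)
    have h2 := (hψ.contMDiff_mul_param h⁻¹).contMDiffAt.comp h h1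
    refine h2.congr_of_eventuallyEq ?_
    filter_upwards [(hψ.chart h).open_source.mem_nhds (hψ.mem_chart_source h)] with x hx
    change x⁻¹ = h⁻¹ * ψ (-(A (hψ.chart h x)))
    rw [hψ.map_neg, ← hA]
    calc x⁻¹ = (h * ψ (hψ.chart h x))⁻¹ := by rw [hψ.mul_chart hx]
      _ = _ := by group
  exact { toContMDiffMul := ⟨hmul⟩, contMDiff_inv := hinv }

theorem isLocalDiffeomorph (hψ : IsLocalParam ψ U) :
    letI := hψ.chartedSpace
    IsLocalDiffeomorph 𝓘(ℝ, E) 𝓘(ℝ, E) ∞ ψ := by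
  let := hψ.chartedSpace
  intro v₀
  let Φ : OpenPartialHomeomorph E G :=
    (Homeomorph.addRight (-v₀)).transOpenPartialHomeomorph (hψ.chart (ψ v₀)).symm
  have hΦ : ∀ v, Φ v = ψ v := fun v => by
    change (hψ.chart (ψ v₀)).symm (v + -v₀) = ψ v
    rw [hψ.chart_symm_apply, ← hψ.map_add]
    congr 1; abel
  have hfwd : ContMDiffOn 𝓘(ℝ, E) 𝓘(ℝ, E) ∞ Φ Φ.source := by
    refine ((hψ.contMDiff_mul_param 1).congr fun v => ?_).contMDiffOn
    rw [hΦ, one_mul]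
  have hbwd : ContMDiffOn 𝓘(ℝ, E) 𝓘(ℝ, E) ∞ Φ.symm Φ.target := by
    have h1 : ContMDiff 𝓘(ℝ, E) 𝓘(ℝ, E) ∞ (fun v : E => v + - -v₀) :=
      (contDiff_id.add contDiff_const).contMDiff
    exact h1.comp_contMDiffOn (hψ.contMDiffOn_chart (ψ v₀))
  refine ⟨⟨Φ.toPartialEquiv, Φ.open_source, Φ.open_target, hfwd, hbwd⟩, ?_, fun v _ => (hΦ v).symm⟩
  change v₀ + -v₀ ∈ U
  rw [add_neg_cancel]
  exact hψ.zero_mem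

end IsLocalParam

end LieStructure

/-! ### The torus acting on the orbit space -/

section TorusAction

open Filter Topology

theorem IsLocalParam.comp_equiv {E F G : Type*} [NormedAddCommGroup E] [NormedSpace ℝ E]
    [NormedAddCommGroup F] [NormedSpace ℝ F] [Group G] [TopologicalSpace G] {ψ : E → G}
    {U : Set E} (hψ : IsLocalParam ψ U) (e : F ≃L[ℝ] E) :
    IsLocalParam (fun x => ψ (e x)) (e ⁻¹' U) where
  map_add v w := by rw [_root_.map_add, hψ.map_add]
  continuous := hψ.continuous.comp e.continuous
  isOpenMap := hψ.isOpenMap.comp e.toHomeomorph.isOpenMap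
  isOpen := hψ.isOpen.preimage e.continuous
  zero_mem := by rw [Set.mem_preimage, _root_.map_zero]; exact hψ.zero_mem
  injOn := hψ.injOn.comp e.injective.injOn fun _ h => h

variable {n : ℕ} (Γ : Subgroup (EuclIsom n))

theorem dist_orbitTranslation_sub_le (v w : centerSpan Γ) (q : OrbitSp Γ) :
    dist (orbitTranslation Γ w q) (orbitTranslation Γ v q) ≤ ‖w - v‖ := by
  have h : orbitTranslation Γ w = orbitTranslation Γ (w - v) * orbitTranslation Γ v := by
    rw [← orbitTranslation_add, sub_add_cancel]
  rw [h]
  exact dist_orbitTranslation_le Γ (w - v) (orbitTranslation Γ v q)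

theorem continuous_orbitTranslation [CompactSpace (OrbitSp Γ)] :
    Continuous (orbitTranslation Γ) := by
  refine continuous_iff_continuousAt.2 fun v => ?_
  refine Metric.nhds_basis_ball.tendsto_iff (isometryEquiv_nhds_basis _) |>.2 fun ε hε => ?_
  refine ⟨ε, hε, fun w hw q => (dist_orbitTranslation_sub_le Γ v w q).trans_lt ?_⟩
  rwa [← mem_ball_iff_norm]

/-- The action of the torus `V/Z(Γ)` on the orbit space. -/
noncomputable def torusAction [DiscreteTopology Γ] : CenterTorus Γ →* OrbitIsom Γ :=
  AddMonoidHom.toMultiplicativeLeft (QuotientAddGroup.lift (centerLattice Γ)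
    ({ toFun := fun v => Additive.ofMul (orbitTranslation Γ v)
       map_zero' := orbitTranslation_zero Γ
       map_add' := orbitTranslation_add Γ } : centerSpan Γ →+ Additive (OrbitIsom Γ))
    fun v hv => (orbitTranslation_eq_one_iff Γ v).2 hv)

theorem torusAction_centerCoset [DiscreteTopology Γ] (v : centerSpan Γ) :
    torusAction Γ (centerCoset Γ v) = orbitTranslation Γ v := rfl

theorem centerCoset_surjective : Function.Surjective (centerCoset Γ) :=
  fun t => QuotientAddGroup.mk_surjective t.toAdd

theorem torusAction_injective [DiscreteTopology Γ] : Function.Injective (torusAction Γ) := by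
  rw [injective_iff_map_eq_one]
  intro t ht
  obtain ⟨v, rfl⟩ := centerCoset_surjective Γ t
  rw [torusAction_centerCoset, orbitTranslation_eq_one_iff] at ht
  exact (QuotientAddGroup.eq_zero_iff v).2 ht

theorem range_torusAction [DiscreteTopology Γ] :
    Set.range (torusAction Γ) = Set.range (orbitTranslation Γ) := by
  rw [← (centerCoset_surjective Γ).range_comp (torusAction Γ)]
  rfl

theorem t2Space_orbitIsom [DiscreteTopology Γ] : T2Space (OrbitIsom Γ) := by
  have := t2Space_orbitSp Γ
  exact t2Space_isometryEquiv

variable [DiscreteTopology Γ] [CompactSpace (OrbitSp Γ)]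

theorem continuous_torusAction : Continuous (torusAction Γ) :=
  (QuotientAddGroup.isQuotientMap_mk (centerLattice Γ)).continuous_iff.2
    (continuous_orbitTranslation Γ)

/-- Rigidity at the identity, moved to v by multiplication. -/
theorem isOpenMap_orbitTranslation : IsOpenMap (orbitTranslation Γ) := by
  obtain ⟨η, hη, hopen⟩ := exists_orbitTranslation_eq Γ
  intro U hU
  rw [isOpen_iff_mem_nhds]
  rintro _ ⟨v, hv, rfl⟩
  obtain ⟨ε, hε, hball⟩ := Metric.isOpen_iff.1 hU v hv
  refine (isometryEquiv_nhds_basis _).mem_iff.2 ⟨min ε η, lt_min hε hη, fun ξ hξ => ?_⟩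
  obtain ⟨w, hw, h⟩ := hopen (min ε η) (min_le_right _ _) (ξ * (orbitTranslation Γ v)⁻¹)
    fun q => by
      have := hξ ((orbitTranslation Γ v).symm q)
      rwa [IsometryEquiv.apply_symm_apply] at this
  refine ⟨w + v, hball ?_, ?_⟩
  · rw [mem_ball_iff_norm, add_sub_cancel_right]
    exact hw.trans_le (min_le_left _ _)
  · rw [orbitTranslation_add, ← h, inv_mul_cancel_right]

theorem exists_isLocalParam_orbitTranslation : ∃ U, IsLocalParam (orbitTranslation Γ) U := by
  obtain ⟨p, r, hr, hp⟩ := exists_dist_orbitTranslation_eq Γ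
  refine ⟨Metric.ball 0 (r / 2), orbitTranslation_add Γ, continuous_orbitTranslation Γ,
    isOpenMap_orbitTranslation Γ, Metric.isOpen_ball, Metric.mem_ball_self (half_pos hr),
    fun v hv w hw h => ?_⟩
  rw [mem_ball_zero_iff] at hv hw
  have h1 : orbitTranslation Γ (v - w) = 1 := by
    have : orbitTranslation Γ (v - w) * orbitTranslation Γ w = orbitTranslation Γ w := by
      rw [← orbitTranslation_add, sub_add_cancel, h]
    exact mul_eq_right.1 this
  have h2 := hp (v - w) ((norm_sub_le v w).trans_lt (by linarith))
  rw [h1] at h2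
  exact sub_eq_zero.1 (norm_eq_zero.1 (h2.symm.trans (dist_self p)))

/-- The range is the image of the connected space V and an open subgroup, hence closed as well. -/
theorem range_torusAction_eq_connectedComponent :
    Set.range (torusAction Γ) = connectedComponent (1 : OrbitIsom Γ) := by
  have : IsTopologicalGroup (OrbitIsom Γ) := isTopologicalGroup_isometryEquiv
  have h1 : (1 : OrbitIsom Γ) ∈ Set.range (torusAction Γ) := ⟨1, map_one _⟩
  refine Set.Subset.antisymm ?_ ?_
  · refine IsPreconnected.subset_connectedComponent ?_ h1
    rw [range_torusAction]
    exact isPreconnected_range (continuous_orbitTranslation Γ)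
  · refine IsClopen.connectedComponent_subset ?_ h1
    have hopen : IsOpen ((torusAction Γ).range : Set (OrbitIsom Γ)) := by
      rw [MonoidHom.coe_range, range_torusAction]
      exact (isOpenMap_orbitTranslation Γ).isOpen_range
    exact ⟨Subgroup.isClosed_of_isOpen _ hopen, hopen⟩

theorem compactSpace_centerTorus : CompactSpace (CenterTorus Γ) := by
  obtain ⟨e⟩ := isTorus_centerTorus Γ
  exact e.toHomeomorph.symm.compactSpace

theorem isEmbedding_torusAction : IsEmbedding (torusAction Γ) := by
  have := compactSpace_centerTorus Γ
  have := t2Space_orbitIsom Γ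
  exact ((continuous_torusAction Γ).isClosedEmbedding (torusAction_injective Γ)).isEmbedding

theorem exists_lieGroup_orbitIsom :
    ∃ _ : ChartedSpace (EuclideanSpace ℝ (Fin (firstBetti Γ))) (OrbitIsom Γ),
      LieGroup (𝓡 (firstBetti Γ)) ∞ (OrbitIsom Γ) ∧
      IsLocalDiffeomorph 𝓘(ℝ, centerSpan Γ) (𝓡 (firstBetti Γ)) ∞ (orbitTranslation Γ) := by
  have : IsTopologicalGroup (OrbitIsom Γ) := isTopologicalGroup_isometryEquiv
  obtain ⟨U, hU⟩ := exists_isLocalParam_orbitTranslation Γ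
  let e : centerSpan Γ ≃L[ℝ] EuclideanSpace ℝ (Fin (firstBetti Γ)) :=
    ContinuousLinearEquiv.ofFinrankEq (by rw [finrank_euclideanSpace_fin, firstBetti_eq_finrank])
  have hψ := hU.comp_equiv e.symm
  refine ⟨hψ.chartedSpace, hψ.lieGroup fun k => ?_, fun v => ?_⟩
  · obtain ⟨A, hA⟩ := exists_conj_orbitTranslation Γ k
    refine ⟨(e : centerSpan Γ →L[ℝ] _) ∘L A ∘L (e.symm : _ →L[ℝ] centerSpan Γ), fun v => ?_⟩
    rw [hA]
    simp
  · let := hψ.chartedSpace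
    have h := (e.toDiffeomorph.isLocalDiffeomorph v).comp (𝓡 (firstBetti Γ)) (OrbitIsom Γ)
      (hψ.isLocalDiffeomorph (e v))
    have he : (fun x => orbitTranslation Γ (e.symm x)) ∘ e.toDiffeomorph =
        orbitTranslation Γ := by
      funext w
      exact congrArg (orbitTranslation Γ) (e.symm_apply_apply w)
    rwa [he] at h

end TorusAction

/-! ### Rank -/

section Rank

theorem circle_eq_one_or_of_sq_eq_one {z : Circle} (hz : z ^ 2 = 1) :
    z = 1 ∨ z = Circle.exp Real.pi := by
  have h : (z : ℂ) ^ 2 = 1 := by exact_mod_cast congrArg (fun w : Circle => (w : ℂ)) hz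
  rcases eq_or_eq_neg_of_sq_eq_sq (z : ℂ) 1 (h.trans (one_pow 2).symm) with h | h
  · exact Or.inl (Circle.ext h)
  · right
    apply Circle.ext
    rw [h, Circle.coe_exp, Complex.exp_pi_mul_I]

theorem circle_exp_pi_sq : Circle.exp Real.pi ^ 2 = 1 := by
  apply Circle.ext
  rw [Circle.coe_pow, Circle.coe_exp, Complex.exp_pi_mul_I]
  norm_num

/-- A torus is not isomorphic to a subgroup of a torus of smaller dimension, even algebraically:
count elements of order two. -/
theorem le_of_injective_circle_hom {a b : ℕ} (F : (Fin a → Circle) →* (Fin b → Circle))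
    (hF : Function.Injective F) : a ≤ b := by
  classical
  -- The 2 ^ a solutions of z² = 1 must inject into the 2 ^ b solutions in the target.
  let x : (Fin a → Bool) → Fin a → Circle := fun s i => bif s i then Circle.exp Real.pi else 1
  have hx : Function.Injective x := by
    intro s t h
    funext i
    have := congrFun h i
    dsimp only [x] at this
    cases hs : s i <;> cases ht : t i <;> rw [hs, ht] at this
    · exact absurd this.symm Circle.exp_pi_ne_one
    · exact absurd this Circle.exp_pi_ne_one
  have hx2 : ∀ s, x s ^ 2 = 1 := fun s => by
    funext i
    change (bif s i then Circle.exp Real.pi else 1) ^ 2 = (1 : Circle)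
    cases s i
    · exact one_pow 2
    · exact circle_exp_pi_sq
  have hy : ∀ s i, F (x s) i = 1 ∨ F (x s) i = Circle.exp Real.pi := fun s i => by
    refine circle_eq_one_or_of_sq_eq_one ?_
    have : F (x s) ^ 2 = 1 := by rw [← map_pow, hx2, map_one]
    exact congrFun this i
  have hinj : Function.Injective fun (s : Fin a → Bool) (i : Fin b) =>
      decide (F (x s) i = 1) := by
    intro s t h
    refine hx (hF (funext fun i => ?_))
    have hi := congrFun h i
    simp only [decide_eq_decide] at hi
    rcases hy s i with h1 | h1
    · rw [h1, hi.1 h1]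
    · rcases hy t i with h2 | h2
      · rw [h2, hi.2 h2]
      · rw [h1, h2]
  have hcard := Fintype.card_le_of_injective _ hinj
  simp only [Fintype.card_pi, Fintype.card_bool, Finset.prod_const, Finset.card_univ,
    Fintype.card_fin] at hcard
  exact (Nat.pow_le_pow_iff_right one_lt_two).1 hcard

/-- A torus subgroup is connected, so it lies in the identity component, itself a torus of dimension
β₁. -/
theorem hasLieRank_orbitIsom {n : ℕ} (Γ : Subgroup (EuclIsom n)) [DiscreteTopology Γ]
    [CompactSpace (OrbitSp Γ)] : HasLieRank (OrbitIsom Γ) (firstBetti Γ) := by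
  obtain ⟨τ⟩ := isTorus_centerTorus Γ
  let ι := MonoidHom.ofInjective (torusAction_injective Γ)
  constructor
  · refine ⟨(torusAction Γ).range, ?_⟩
    have := t2Space_orbitIsom Γ
    let f : (Fin (firstBetti Γ) → Circle) ≃* (torusAction Γ).range := τ.symm.toMulEquiv.trans ι
    have hf : Continuous f.toEquiv :=
      ((continuous_torusAction Γ).comp τ.symm.continuous).subtype_mk _
    exact ⟨{ f.symm with
      continuous_toFun := hf.continuous_symm_of_equiv_compact_to_t2
      continuous_invFun := hf }⟩
  · rintro d ⟨T, ⟨φ⟩⟩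
    have hT : ∀ x : T, (x : OrbitIsom Γ) ∈ (torusAction Γ).range := by
      intro x
      rw [← SetLike.mem_coe, MonoidHom.coe_range, range_torusAction_eq_connectedComponent]
      have hc : IsPreconnected (Set.range fun z => (φ.symm z : OrbitIsom Γ)) :=
        isPreconnected_range (continuous_subtype_val.comp φ.symm.continuous)
      refine hc.subset_connectedComponent ⟨1, ?_⟩ ⟨φ x, ?_⟩
      · exact congrArg Subtype.val (map_one φ.symm)
      · exact congrArg Subtype.val (φ.symm_apply_apply x)
    have hle : T ≤ (torusAction Γ).range := fun x hx => hT ⟨x, hx⟩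
    refine le_of_injective_circle_hom (τ.toMulEquiv.toMonoidHom.comp
      (ι.symm.toMonoidHom.comp ((Subgroup.inclusion hle).comp φ.symm.toMulEquiv.toMonoidHom))) ?_
    exact τ.injective.comp (ι.symm.injective.comp
      ((Subgroup.inclusion_injective hle).comp φ.symm.injective))

end Rank

theorem theorem11 {n : ℕ} (Γ : Subgroup (EuclIsom n)) (hΓ : IsSpaceGroup Γ) :
    -- the center consists of translations by vectors of `V = Span(Z(Γ))`
    (∀ γ ∈ centerIn Γ, ∃ v : centerSpan Γ, γ = euclTranslation (v : EuclSp n)) ∧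
    -- `V/Z(Γ)` is a torus, of dimension the first Betti number of `Γ`
    IsTorus (CenterTorus Γ) (firstBetti Γ) ∧
    -- `Isom(Eⁿ/Γ)` is a compact Hausdorff group
    CompactSpace (OrbitIsom Γ) ∧ T2Space (OrbitIsom Γ) ∧
    -- its topology underlies a Lie group structure
    (∃ _ : ChartedSpace (EuclideanSpace ℝ (Fin (firstBetti Γ))) (OrbitIsom Γ),
      LieGroup (𝓡 (firstBetti Γ)) ∞ (OrbitIsom Γ) ∧
      -- the effective action of `V/Z(Γ)` on `Eⁿ/Γ` by isometries, given by the stated formula,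
      -- is an isomorphism onto the identity component, of topological groups and of Lie groups
      ∃ Ψ : CenterTorus Γ →* OrbitIsom Γ,
        (∀ (v : centerSpan Γ) (x : EuclSp n),
          Ψ (centerCoset Γ v) (orbitPt Γ x) = orbitPt Γ ((v : EuclSp n) + x)) ∧
        Topology.IsEmbedding Ψ ∧
        Set.range Ψ = connectedComponent (1 : OrbitIsom Γ) ∧
        IsLocalDiffeomorph 𝓘(ℝ, centerSpan Γ) (𝓡 (firstBetti Γ)) ∞
          (fun v : centerSpan Γ => Ψ (centerCoset Γ v))) ∧
    -- the rank of the compact Lie group `Isom(Eⁿ/Γ)` is the first Betti number of `Γ`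
    HasLieRank (OrbitIsom Γ) (firstBetti Γ) := by
  have := hΓ.discrete
  have := hΓ.compact
  have := t2Space_orbitSp Γ
  obtain ⟨hcs, hlie, hdiff⟩ := exists_lieGroup_orbitIsom Γ
  exact ⟨fun γ hγ => centerIn_eq_translation Γ hγ, isTorus_centerTorus Γ,
    compactSpace_isometryEquiv, t2Space_isometryEquiv,
    ⟨hcs, hlie, torusAction Γ, fun v x => rfl, isEmbedding_torusAction Γ,
      range_torusAction_eq_connectedComponent Γ, hdiff⟩,
    hasLieRank_orbitIsom Γ⟩
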